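/- A subsequence of a permutation $\pi$ has type $\sigma$ if its entries are in the same relative order as those of $\sigma$; $[m]$ denotes the decreasing permutation $m\cdots 21$, and $|\pi|$ is the length of $\pi$. For $m,r\ge 1$ let $$S_{m,r}(x)=\sum_{\pi}\operatorname{sign}(\pi)\,x^{|\pi|},$$ a formal power series, where the sum is over all involutions $\pi$ of any length $n\ge 0$ which contain no subsequence of type $3412$ and exactly $r$ subsequences of type $[m]$, and $\operatorname{sign}(\pi)=\pm1$ is the usual sign. Let $W_n=W_n(x)=U_n\!\left(\frac{1-x}{2ix}\right)$, where $i^2=-1$ and $U_n$ is the Chebyshev polynomial of the second kind, $U_n(\cos t)=\sin((n+1)t)/\sin t$. Use the convention $\binom{a}{0}=1$ for every integer $a$. The identities below hold in the field of formal Laurent series in $x$ over $\mathbb{C}$. (a) Let $r\ge1$, $k\ge1$, $b\ge0$ be integers with $r<\min\left(\binom{2k+2b+2}{2k-1},\binom{2k+2b}{2k-1}+\binom{2k+2b+1}{2k-1}\right)$. Then $$S_{2k,r}(x)=\sum\ \prod_{s=0}^b\binom{d_s+d_{s+1}+l_s-1}{d_{s+1}+l_s}\binom{d_{s+1}+l_s}{l_s}\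 \frac{W_{k-1}^{d_0-1}}{W_k^{d_0+1}}\ i^{\sum_{j=0}^b2d_j-d_0-1}\ x^{-1-d_0+\sum_{j=0}^b(2d_j+l_j)},$$ where $d_{b+1}=0$ and the sum is over the finitely many sequences $d_0,\dots,d_b$, $l_0,\dots,l_b$ of nonnegative integers such that $$r=\sum_{j=0}^b d_j\left(\binom{2k+2j-2}{2k-1}+\binom{2k+2j-1}{2k-1}\right)+\sum_{j=0}^b l_j\binom{2k+2j}{2k-1}.$$ (b) Let $r\ge1$, $k\ge1$, $b\ge0$ be integers with $\binom{2k+2b}{2k}\le r<\binom{2k+2b+2}{2k}$. Then $$S_{2k+1,r}(x)=\sum\ \prod_{s=0}^b\binom{d_s+d_{s-1}+l_s-1}{d_s+l_s}\binom{d_s+l_s}{l_s}\ \frac{W_k^{d_0+l_0-1}}{(W_{k+1}-iW_k)^{d_0+l_0+1}}\ i^{-1-d_0-l_0+\sum_{j=0}^b2d_j}\ x^{-1-d_0-l_0+\sum_{j=0}^b(2d_j+l_j)},$$ where $d_{-1}=1$ and the sum is over the finitely many sequences $d_0,\dots,d_b$, $l_0,\dots,l_b$ of nonnegative integers such that $$r=\sum_{j=0}^b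 d_j\left(\binom{2k+2j+1}{2k}+\binom{2k+2j}{2k}\right)+\sum_{j=0}^b l_j\binom{2k+2j}{2k}.$$ (c) For all $k\ge1$, $S_{2k,1}(x)=\dfrac{1}{W_k^2}$. (d) For all $k\ge1$, $S_{2k+1,1}(x)=\dfrac{-1}{x\,(W_{k+1}-iW_k)^2}$. -/

import Mathlib

/-! Permutation patterns.  A permutation of length `n` is an element of `Equiv.Perm (Fin n)`;
positions and values are numbered from `0`. -/

/-- The number of subsequences of `π` of type `σ`.  A subsequence of length `m` is given by its
strictly increasing sequence `f` of positions. -/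
def patternCount {m n : ℕ} (σ : Equiv.Perm (Fin m)) (π : Equiv.Perm (Fin n)) : ℕ :=
  Finset.card {f : Fin m → Fin n |
    (∀ a b, a < b → f a < f b) ∧ ∀ a b, π (f a) < π (f b) ↔ σ a < σ b}

/-- The permutation `3412`. -/
def perm3412 : Equiv.Perm (Fin 4) where
  toFun := ![2, 3, 0, 1]
  invFun := ![2, 3, 0, 1]
  left_inv := by decide
  right_inv := by decide

/-- The decreasing permutation `[m] = m … 2 1`. -/
def decPerm (m : ℕ) : Equiv.Perm (Fin m) := Fin.revPerm

/-- The involutions of length `n` which avoid `3412` and contain exactly `r` subsequences of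
type `[m]`. -/
def involutionsWith (m r n : ℕ) : Finset (Equiv.Perm (Fin n)) :=
  {π | (∀ j, π (π j) = j) ∧ patternCount perm3412 π = 0 ∧ patternCount (decPerm m) π = r}

/-- The formal power series `∑ sign(π) x^|π|`, over all involutions `π` (of any length) which
avoid `3412` and contain exactly `r` subsequences of type `[m]`. -/
noncomputable def signedGF (m r : ℕ) : PowerSeries ℂ :=
  PowerSeries.mk fun n => ∑ π ∈ involutionsWith m r n, ((Equiv.Perm.sign π : ℤ) : ℂ)

/-! The field of formal Laurent series in `x` over `ℂ`, in which the right-hand sides live. -/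

/-- The indeterminate `x`. -/
noncomputable def xL : LaurentSeries ℂ := HahnSeries.single (1 : ℤ) (1 : ℂ)

/-- The constant `i`. -/
noncomputable def iL : LaurentSeries ℂ := HahnSeries.C Complex.I

/-- `W_n = U_n((1 - x) / (2 i x))`, with `U_n` the Chebyshev polynomial of the second kind. -/
noncomputable def W (n : ℕ) : LaurentSeries ℂ :=
  (Polynomial.Chebyshev.U (LaurentSeries ℂ) (n : ℤ)).eval ((1 - xL) / (2 * iL * xL))

/-! The index sets and the summands.  A pair `p` consists of the sequences `d_0, …, d_b` (`p.1`)
and `l_0, …, l_b` (`p.2`).  The binomial coefficients `a` choose `m` follow the convention that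
the value is `1` for `m = 0`, also for `a = -1`; the truncated subtraction below agrees with it,
because the lower index is `0` whenever the upper index would be `-1`. -/

/-- The sequences which satisfy the weight equation for `[2k]`. -/
def evenSeqs (r k b : ℕ) : Set ((Fin (b + 1) → ℕ) × (Fin (b + 1) → ℕ)) :=
  {p | r = ∑ j, p.1 j * ((2 * k + 2 * (j : ℕ) - 2).choose (2 * k - 1)
              + (2 * k + 2 * (j : ℕ) - 1).choose (2 * k - 1))
         + ∑ j, p.2 j * (2 * k + 2 * (j : ℕ)).choose (2 * k - 1)}

/-- `∏ₛ (d_s + d_{s+1} + l_s - 1 choose d_{s+1} + l_s) (d_{s+1} + l_s choose l_s)`, where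
`d_{b+1} = 0`. -/
def evenCoeff {b : ℕ} (d l : Fin (b + 1) → ℕ) : ℕ :=
  let e : Fin (b + 2) → ℕ := Fin.snoc d 0
  ∏ s, (d s + e s.succ + l s - 1).choose (e s.succ + l s) * (e s.succ + l s).choose (l s)

/-- The summand for `[2k]` belonging to the sequences `d` and `l`. -/
noncomputable def evenTerm (k : ℕ) {b : ℕ} (d l : Fin (b + 1) → ℕ) : LaurentSeries ℂ :=
  (evenCoeff d l : LaurentSeries ℂ)
    * (W (k - 1) ^ ((d 0 : ℤ) - 1) / W k ^ ((d 0 : ℤ) + 1))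
    * iL ^ ((∑ j, 2 * (d j : ℤ)) - (d 0 : ℤ) - 1)
    * xL ^ (-1 - (d 0 : ℤ) + ∑ j, (2 * (d j : ℤ) + (l j : ℤ)))

/-- The sequences which satisfy the weight equation for `[2k+1]`. -/
def oddSeqs (r k b : ℕ) : Set ((Fin (b + 1) → ℕ) × (Fin (b + 1) → ℕ)) :=
  {p | r = ∑ j, p.1 j * ((2 * k + 2 * (j : ℕ) + 1).choose (2 * k)
              + (2 * k + 2 * (j : ℕ)).choose (2 * k))
         + ∑ j, p.2 j * (2 * k + 2 * (j : ℕ)).choose (2 * k)}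

/-- `∏ₛ (d_s + d_{s-1} + l_s - 1 choose d_s + l_s) (d_s + l_s choose l_s)`, where
`d_{-1} = 1`. -/
def oddCoeff {b : ℕ} (d l : Fin (b + 1) → ℕ) : ℕ :=
  let e : Fin (b + 2) → ℕ := Fin.cons 1 d
  ∏ s, (d s + e s.castSucc + l s - 1).choose (d s + l s) * (d s + l s).choose (l s)

/-- The summand for `[2k+1]` belonging to the sequences `d` and `l`. -/
noncomputable def oddTerm (k : ℕ) {b : ℕ} (d l : Fin (b + 1) → ℕ) : LaurentSeries ℂ :=
  (oddCoeff d l : LaurentSeries ℂ)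
    * (W k ^ ((d 0 : ℤ) + (l 0 : ℤ) - 1)
        / (W (k + 1) - iL * W k) ^ ((d 0 : ℤ) + (l 0 : ℤ) + 1))
    * iL ^ (-1 - (d 0 : ℤ) - (l 0 : ℤ) + ∑ j, 2 * (d j : ℤ))
    * xL ^ (-1 - (d 0 : ℤ) - (l 0 : ℤ) + ∑ j, (2 * (d j : ℤ) + (l j : ℤ)))

/-!
An involution avoids `3412` exactly when no two of its `2`-cycles cross (`exists_encodes`), so such
involutions correspond to Motzkin words, written here as trees: a level step is a fixed point and
an arch is a `2`-cycle, of sign `-1`. A point at the end of an arch forms an inversion with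
everything inside the arch, and points of different components of the word form no inversion. Hence
the generating polynomial of the decreasing subsequences is multiplied by `(1 + X) ^ 2` by an arch
and is additive, up to the empty subsequence, over components. It follows that the number of
subsequences of type `[q + 1]` is a sum over the steps of the word: a fixed point below `h` arches
contributes `(2h choose q)` and an arch below `h` arches contributes
`(2h choose q) + (2h + 1 choose q)` (`MotzkinTree.coeff_poly`).

Let `G_h` be the signed generating function of the words at height `h`, where `x` marks the length
and `u` the contributions of the steps. Splitting off the first step gives
`G_h = 1 / (1 - x u ^ c_h + x² u ^ e_h G_{h+1})` (`weightGF_mul`), a continued fraction whose lower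
levels do not involve `u`. These levels combine to a quotient of linear expressions in the remaining part, with
coefficients the denominators of the convergents of `1 / (1 - x + x² / ⋯)` (`convergent_mul`); up
to powers of `i x` those are the values `W n` of the Chebyshev polynomials (`convergentDen_eq_W`).
By the determinant identity for convergents, the coefficient of `u ^ r` for `r ≥ 1` is therefore an
explicit factor times the coefficient of `u ^ r` in a geometric series (`coeff_of_mul_linear_eq`).

The levels with marks are expanded one after the other by the binomial series
(`coeff_pow_continuedFraction`), which yields the products of binomial coefficients. The levels
whose marks exceed `r` do not matter, so the expansion stops after finitely many of them, and the
marks that remain are positive, so the sums are finite.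
-/

/-! ### Motzkin trees -/

/-- Motzkin words, in the form of trees: a word is empty, or a level step followed by a word, or
an arch enclosing a word, followed by a word. -/
inductive MotzkinTree : Type
  | nil : MotzkinTree
  | flat : MotzkinTree → MotzkinTree
  | arch : MotzkinTree → MotzkinTree → MotzkinTree

namespace MotzkinTree

/-- The number of steps: a level step counts once, an arch twice. -/
def size : MotzkinTree → ℕ
  | nil => 0
  | flat t => t.size + 1
  | arch s t => s.size + t.size + 2

/-- The number of arches. -/
def arches : MotzkinTree → ℕ
  | nil => 0
  | flat t => t.arches
  | arch s t => s.arches + t.arches + 1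

/-- The function `f` acts on the positions `a, …, a + t.size - 1` as the involution described by
`t`: level steps are fixed points, and arches are `2`-cycles. -/
def Encodes (f : ℕ → ℕ) : ℕ → MotzkinTree → Prop
  | _, nil => True
  | a, flat t => f a = a ∧ Encodes f (a + 1) t
  | a, arch s t => f a = a + s.size + 1 ∧ f (a + s.size + 1) = a ∧ Encodes f (a + 1) s ∧
      Encodes f (a + s.size + 2) t

/-- The involution described by a tree which starts at position `a`; its values outside the
positions of the tree do not matter. -/
def toFun : MotzkinTree → ℕ → ℕ → ℕ
  | nil, _, x => x
  | flat t, a, x => if x = a then a else t.toFun (a + 1) x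
  | arch s t, a, x =>
      if x = a then a + s.size + 1 else if x = a + s.size + 1 then a
      else if x < a + s.size + 1 then s.toFun (a + 1) x else t.toFun (a + s.size + 2) x

theorem Encodes.congr {f g : ℕ → ℕ} {a : ℕ} {t : MotzkinTree} (h : Encodes f a t)
    (hfg : ∀ x, a ≤ x → x < a + t.size → f x = g x) : Encodes g a t := by
  induction t generalizing a with
  | nil => trivial
  | flat t ih =>
    simp only [size] at hfg
    exact ⟨by rw [← hfg a (by omega) (by omega)]; exact h.1,
      ih h.2 fun x h1 h2 => hfg x (by omega) (by omega)⟩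
  | arch s t ihs iht =>
    simp only [size] at hfg
    obtain ⟨h1, h2, h3, h4⟩ := h
    exact ⟨by rw [← hfg a (by omega) (by omega)]; exact h1,
      by rw [← hfg _ (by omega) (by omega)]; exact h2,
      ihs h3 fun x h1 h2 => hfg x (by omega) (by omega),
      iht h4 fun x h1 h2 => hfg x (by omega) (by omega)⟩

theorem encodes_toFun (t : MotzkinTree) (a : ℕ) : Encodes (t.toFun a) a t := by
  induction t generalizing a with
  | nil => trivial
  | flat t ih =>
    refine ⟨by simp [toFun], (ih (a + 1)).congr fun x h1 h2 => ?_⟩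
    simp [toFun, show x ≠ a by omega]
  | arch s t ihs iht =>
    refine ⟨by simp [toFun], by simp [toFun], (ihs (a + 1)).congr fun x h1 h2 => ?_,
      (iht (a + s.size + 2)).congr fun x h1 h2 => ?_⟩
    · simp [toFun, show x ≠ a by omega, show x ≠ a + s.size + 1 by omega,
        show x < a + s.size + 1 by omega]
    · simp [toFun, show x ≠ a by omega, show x ≠ a + s.size + 1 by omega,
        show ¬ x < a + s.size + 1 by omega]

/-- Every position of an arch is one of the two ends, or lies inside, or lies to the right. -/
theorem arch_position {s t : MotzkinTree} {a x : ℕ} (h1 : a ≤ x) (h2 : x < a + (arch s t).size) :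
    x = a ∨ x = a + s.size + 1 ∨ (a + 1 ≤ x ∧ x < a + 1 + s.size) ∨
      (a + s.size + 2 ≤ x ∧ x < a + s.size + 2 + t.size) := by
  simp only [size] at h2
  omega

theorem Encodes.mapsTo {f : ℕ → ℕ} {a : ℕ} {t : MotzkinTree} (h : Encodes f a t) {x : ℕ}
    (h1 : a ≤ x) (h2 : x < a + t.size) : a ≤ f x ∧ f x < a + t.size := by
  induction t generalizing a with
  | nil => simp only [size] at h2; omega
  | flat t ih =>
    simp only [size] at h2 ⊢
    rcases h1.eq_or_lt with rfl | h1
    · rw [h.1]; omega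
    · have := ih h.2 h1 (by omega)
      omega
  | arch s t ihs iht =>
    obtain ⟨e1, e2, e3, e4⟩ := h
    rcases arch_position h1 h2 with rfl | rfl | ⟨h3, h4⟩ | ⟨h3, h4⟩ <;> simp only [size]
    · omega
    · omega
    · have := ihs e3 h3 h4; omega
    · have := iht e4 h3 h4; omega

theorem Encodes.involutive {f : ℕ → ℕ} {a : ℕ} {t : MotzkinTree} (h : Encodes f a t) {x : ℕ}
    (h1 : a ≤ x) (h2 : x < a + t.size) : f (f x) = x := by
  induction t generalizing a with
  | nil => simp only [size] at h2; omega
  | flat t ih =>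
    simp only [size] at h2
    rcases h1.eq_or_lt with rfl | h1
    · rw [h.1, h.1]
    · exact ih h.2 h1 (by omega)
  | arch s t ihs iht =>
    obtain ⟨e1, e2, e3, e4⟩ := h
    rcases arch_position h1 h2 with rfl | rfl | ⟨h3, h4⟩ | ⟨h3, h4⟩
    · rw [e1, e2]
    · rw [e2, e1]
    · exact ihs e3 h3 h4
    · exact iht e4 h3 h4

/-- An involution described by a tree avoids `3412`. -/
theorem Encodes.avoids {f : ℕ → ℕ} {a : ℕ} {t : MotzkinTree} (h : Encodes f a t)
    {x y z w : ℕ} (h1 : a ≤ x) (hxy : x < y) (hyz : y < z) (hzw : z < w) (h2 : w < a + t.size) :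
    ¬ (f z < f w ∧ f w < f x ∧ f x < f y) := by
  induction t generalizing a with
  | nil => simp only [size] at h2; omega
  | flat t ih =>
    simp only [size] at h2
    rcases h1.eq_or_lt with rfl | h1
    · have := h.2.mapsTo (x := w) (by omega) (by omega)
      rw [h.1]; omega
    · exact ih h.2 h1 (by omega)
  | arch s t ihs iht =>
    obtain ⟨e1, e2, e3, e4⟩ := h
    have hx := arch_position (s := s) (t := t) (x := x) h1 (by omega)
    have hy := arch_position (x := y) (by omega) (by omega : _ < a + (arch s t).size)
    have hz := arch_position (x := z) (by omega) (by omega : _ < a + (arch s t).size)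
    have hw := arch_position (x := w) (by omega) h2
    have key : ∀ u, (a + 1 ≤ u ∧ u < a + 1 + s.size) → a + 1 ≤ f u ∧ f u < a + 1 + s.size :=
      fun u hu => e3.mapsTo hu.1 hu.2
    have key' : ∀ u, (a + s.size + 2 ≤ u ∧ u < a + s.size + 2 + t.size) →
        a + s.size + 2 ≤ f u ∧ f u < a + s.size + 2 + t.size :=
      fun u hu => e4.mapsTo hu.1 hu.2
    by_cases hins : a + 1 ≤ x ∧ w < a + 1 + s.size
    · exact ihs e3 hins.1 hins.2
    by_cases hout : a + s.size + 2 ≤ x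
    · exact iht e4 hout (by simp only [size] at h2; omega)
    have kx := key x
    have ky := key y
    have kz := key z
    have kw := key w
    have kx' := key' x
    have ky' := key' y
    have kz' := key' z
    have kw' := key' w
    rcases hx with rfl | rfl | hx | hx <;> rcases hy with rfl | rfl | hy | hy <;>
      rcases hz with rfl | rfl | hz | hz <;> rcases hw with rfl | rfl | hw | hw <;> omega

theorem Encodes.unique {f : ℕ → ℕ} {a : ℕ} {t t' : MotzkinTree} (h : Encodes f a t)
    (h' : Encodes f a t') (hs : t.size = t'.size) : t = t' := by
  induction t generalizing a t' with
  | nil => cases t' <;> simp_all [size]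
  | flat t ih =>
    cases t' with
    | nil => simp [size] at hs
    | flat t' => rw [ih h.2 h'.2 (by simpa [size] using hs)]
    | arch s' t' => have := h.1; have := h'.1; omega
  | arch s t ihs iht =>
    cases t' with
    | nil => simp [size] at hs
    | flat t' => have := h.1; have := h'.1; omega
    | arch s' t' =>
      have h1 := h.1
      have h2 := h'.1
      have h3 : s.size = s'.size := by omega
      obtain rfl := ihs h.2.2.1 h'.2.2.1 h3
      obtain rfl := iht h.2.2.2 h'.2.2.2 (by simpa [size] using hs)
      rfl

/-- The involution described by a tree is determined by the tree. -/
theorem Encodes.eqOn {f g : ℕ → ℕ} {a : ℕ} {t : MotzkinTree} (hf : Encodes f a t)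
    (hg : Encodes g a t) {x : ℕ} (h1 : a ≤ x) (h2 : x < a + t.size) : f x = g x := by
  induction t generalizing a with
  | nil => simp only [size] at h2; omega
  | flat t ih =>
    simp only [size] at h2
    rcases h1.eq_or_lt with rfl | h1
    · rw [hf.1, hg.1]
    · exact ih hf.2 hg.2 h1 (by omega)
  | arch s t ihs iht =>
    rcases arch_position h1 h2 with rfl | rfl | ⟨h3, h4⟩ | ⟨h3, h4⟩
    · rw [hf.1, hg.1]
    · rw [hf.2.1, hg.2.1]
    · exact ihs hf.2.2.1 hg.2.2.1 h3 h4
    · exact iht hf.2.2.2 hg.2.2.2 h3 h4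

/-- Every involution of an interval which avoids `3412` is described by a tree: if the first point
`a` is not fixed, then no `2`-cycle leads from the points between `a` and `f a` to points beyond
`f a`, since together with `a` and `f a` it would form a `3412`. -/
theorem exists_encodes {f : ℕ → ℕ} (n : ℕ) {a : ℕ}
    (hmaps : ∀ x, a ≤ x → x < a + n → a ≤ f x ∧ f x < a + n)
    (hinv : ∀ x, a ≤ x → x < a + n → f (f x) = x)
    (havoid : ∀ x y z w, a ≤ x → x < y → y < z → z < w → w < a + n →
      ¬ (f z < f w ∧ f w < f x ∧ f x < f y)) :
    ∃ t : MotzkinTree, t.size = n ∧ Encodes f a t := by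
  induction n using Nat.strong_induction_on generalizing a with
  | _ n ih =>
    rcases n with _ | n
    · exact ⟨nil, rfl, trivial⟩
    have hinj : ∀ x y, a ≤ x → x < a + (n + 1) → a ≤ y → y < a + (n + 1) → f x = f y → x = y :=
      fun x y h1 h2 h3 h4 h => by rw [← hinv x h1 h2, h, hinv y h3 h4]
    have hfa := hmaps a le_rfl (by omega)
    have hffa := hinv a le_rfl (by omega)
    by_cases hfix : f a = a
    · obtain ⟨t, ht, het⟩ := ih n (by omega) (a := a + 1)
        (fun x h1 h2 => by
          have h3 := hmaps x (by omega) (by omega)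
          have : f x ≠ a := fun h => by
            have := hinj x a (by omega) (by omega) le_rfl (by omega) (h.trans hfix.symm); omega
          omega)
        (fun x h1 h2 => hinv x (by omega) (by omega))
        (fun x y z w h1 h2 h3 h4 h5 => havoid x y z w (by omega) h2 h3 h4 (by omega))
      exact ⟨flat t, by simp [size, ht], hfix, het⟩
    · obtain ⟨p, hp⟩ : ∃ p, f a = a + p + 1 := ⟨f a - a - 1, by omega⟩
      obtain ⟨q, hq⟩ : ∃ q, n = p + q + 1 := ⟨n - p - 1, by omega⟩
      have hne : ∀ x, a < x → x < a + (n + 1) → x ≠ a + p + 1 → f x ≠ a ∧ f x ≠ a + p + 1 := by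
        intro x h1 h2 h3
        refine ⟨fun h => h3 ?_, fun h => h1.ne ?_⟩
        · rw [← hinv x (by omega) (by omega), h, hp]
        · exact hinj a x le_rfl (by omega) (by omega) (by omega) (by rw [h, hp])
      have hin : ∀ x, a + 1 ≤ x → x < a + 1 + p → a + 1 ≤ f x ∧ f x < a + 1 + p := by
        intro x h1 h2
        have h3 := hmaps x (by omega) (by omega)
        have h4 := hne x (by omega) (by omega) (by omega)
        by_contra hcon
        have h5 := hinv x (by omega) (by omega)
        rw [hp] at hffa
        exact havoid a x (a + p + 1) (f x) le_rfl (by omega) (by omega) (by omega) h3.2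
          ⟨by omega, by omega, by omega⟩
      have hout : ∀ x, a + p + 2 ≤ x → x < a + p + 2 + q →
          a + p + 2 ≤ f x ∧ f x < a + p + 2 + q := by
        intro x h1 h2
        have h3 := hmaps x (by omega) (by omega)
        have h4 := hne x (by omega) (by omega) (by omega)
        by_contra hcon
        have h5 := hin (f x) (by omega) (by omega)
        rw [hinv x (by omega) (by omega)] at h5
        omega
      obtain ⟨s, hs, hes⟩ := ih p (by omega) (a := a + 1) hin
        (fun x h1 h2 => hinv x (by omega) (by omega))
        (fun x y z w h1 h2 h3 h4 h5 => havoid x y z w (by omega) h2 h3 h4 (by omega))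
      obtain ⟨t, ht, het⟩ := ih q (by omega) (a := a + p + 2) hout
        (fun x h1 h2 => hinv x (by omega) (by omega))
        (fun x y z w h1 h2 h3 h4 h5 => havoid x y z w (by omega) h2 h3 h4 (by omega))
      refine ⟨arch s t, by simp only [size]; omega, ?_, ?_, hes, ?_⟩
      · rw [hs]; exact hp
      · rw [hs, ← hp]; exact hffa
      · rw [hs]; exact het

end MotzkinTree

/-! ### Decreasing subsequences -/

section DecreasingSubsequences

open Polynomial

open Classical in
/-- The generating polynomial, by length, of the decreasing subsequences of `f` (the empty one
included) with positions in `I`. -/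
noncomputable def decreasingPoly (f : ℕ → ℕ) (I : Finset ℕ) : ℤ[X] :=
  ∑ S ∈ I.powerset.filter fun S : Finset ℕ => StrictAntiOn f (S : Set ℕ), X ^ S.card

theorem coeff_decreasingPoly (f : ℕ → ℕ) (I : Finset ℕ) (m : ℕ) :
    (decreasingPoly f I).coeff m =
      {S : Finset ℕ | S ⊆ I ∧ StrictAntiOn f (S : Set ℕ) ∧ S.card = m}.ncard := by
  classical
  simp only [decreasingPoly, finsetSum_coeff, coeff_X_pow, Finset.sum_boole]
  rw [← Set.ncard_coe_finset]
  congr 2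
  ext S
  simp [and_assoc, eq_comm]

theorem decreasingPoly_empty (f : ℕ → ℕ) : decreasingPoly f ∅ = 1 := by
  simp [decreasingPoly, Finset.sum_filter, StrictAntiOn]

/-- A position which forms an inversion with all others can be added to every decreasing
subsequence. -/
theorem decreasingPoly_insert {f : ℕ → ℕ} {a : ℕ} {I : Finset ℕ}
    (h : ∀ x ∈ I, (a < x ∧ f x < f a) ∨ (x < a ∧ f a < f x)) :
    decreasingPoly f (insert a I) = (1 + X) * decreasingPoly f I := by
  classical
  have ha : a ∉ I := fun ha => by have := h a ha; omega
  simp only [decreasingPoly, Finset.sum_filter]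
  rw [Finset.sum_powerset_insert ha, add_mul, one_mul, Finset.mul_sum]
  congr 1
  refine Finset.sum_congr rfl fun S hS => ?_
  rw [Finset.mem_powerset] at hS
  have haS : a ∉ S := fun h => ha (hS h)
  have : StrictAntiOn f (insert a S : Finset ℕ) ↔ StrictAntiOn f (S : Set ℕ) := by
    refine ⟨fun H => H.mono (by simp), fun H x hx y hy hxy => ?_⟩
    simp only [Finset.coe_insert, Set.mem_insert_iff, Finset.mem_coe] at hx hy
    rcases hx with rfl | hx <;> rcases hy with rfl | hy
    · omega
    · have := h y (hS hy); omega
    · have := h x (hS hx); omega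
    · exact H hx hy hxy
  rw [Finset.card_insert_of_notMem haS]
  simp only [this, mul_ite, mul_zero, pow_succ']

/-- If `I` and `J` have no inversion between them, then a decreasing subsequence stays in one of
them; the empty one is counted twice. -/
theorem decreasingPoly_union {f : ℕ → ℕ} {I J : Finset ℕ}
    (h : ∀ x ∈ I, ∀ y ∈ J, x < y ∧ f x < f y) :
    decreasingPoly f (I ∪ J) = decreasingPoly f I + decreasingPoly f J - 1 := by
  classical
  rw [eq_sub_iff_add_eq]
  simp only [decreasingPoly]
  rw [← Finset.sum_union_inter]
  congr 1
  · refine Finset.sum_congr ?_ fun _ _ => rfl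
    ext S
    simp only [Finset.mem_filter, Finset.mem_powerset, Finset.mem_union]
    constructor
    · rintro ⟨hS, H⟩
      by_cases hI : S ⊆ I
      · exact Or.inl ⟨hI, H⟩
      · obtain ⟨y, hy, hyI⟩ := Finset.not_subset.mp hI
        have hyJ : y ∈ J := (Finset.mem_union.mp (hS hy)).resolve_left hyI
        refine Or.inr ⟨fun x hx => (Finset.mem_union.mp (hS hx)).resolve_left fun hxI => ?_, H⟩
        have h1 := h x hxI y hyJ
        have h2 := H hx hy h1.1
        omega
    · rintro (⟨hS, H⟩ | ⟨hS, H⟩)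
      · exact ⟨hS.trans Finset.subset_union_left, H⟩
      · exact ⟨hS.trans Finset.subset_union_right, H⟩
  · have : ((I.powerset.filter fun S : Finset ℕ => StrictAntiOn f (S : Set ℕ)) ∩
        (J.powerset.filter fun S : Finset ℕ => StrictAntiOn f (S : Set ℕ))) = {∅} := by
      ext S
      simp only [Finset.mem_inter, Finset.mem_filter, Finset.mem_powerset, Finset.mem_singleton]
      constructor
      · rintro ⟨⟨h1, -⟩, h2, -⟩
        refine Finset.eq_empty_of_forall_notMem fun x hx => ?_
        exact lt_irrefl _ (h x (h1 hx) x (h2 hx)).1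
      · rintro rfl
        simp [StrictAntiOn]
    rw [this]
    simp

namespace MotzkinTree

/-- The generating polynomial of the decreasing subsequences of the involution described by a
tree. -/
noncomputable def poly : MotzkinTree → ℤ[X]
  | nil => 1
  | flat t => X + t.poly
  | arch s t => (1 + X) ^ 2 * s.poly + t.poly - 1

theorem Encodes.decreasingPoly_eq {f : ℕ → ℕ} {a : ℕ} {t : MotzkinTree} (h : Encodes f a t) :
    decreasingPoly f (Finset.Ico a (a + t.size)) = t.poly := by
  induction t generalizing a with
  | nil => simp [size, poly, decreasingPoly_empty]
  | flat t ih =>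
    have e : Finset.Ico a (a + (flat t).size) =
        insert a ∅ ∪ Finset.Ico (a + 1) (a + 1 + t.size) := by
      ext x; simp [size]; omega
    rw [e, decreasingPoly_union, decreasingPoly_insert (by simp), ih h.2, decreasingPoly_empty,
      poly]
    · ring
    · intro x hx y hy
      simp only [insert_empty_eq, Finset.mem_singleton, Finset.mem_Ico] at hx hy
      have h1 := h.2.mapsTo hy.1 hy.2
      rw [hx, h.1]
      omega
  | arch s t ihs iht =>
    obtain ⟨e1, e2, e3, e4⟩ := h
    have e : Finset.Ico a (a + (arch s t).size) =
        insert a (insert (a + s.size + 1) (Finset.Ico (a + 1) (a + 1 + s.size))) ∪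
          Finset.Ico (a + s.size + 2) (a + s.size + 2 + t.size) := by
      ext x; simp only [size, Finset.mem_Ico, Finset.mem_union, Finset.mem_insert]; omega
    rw [e, decreasingPoly_union, decreasingPoly_insert, decreasingPoly_insert, ihs e3, iht e4,
      poly]
    · ring
    · intro x hx
      rw [Finset.mem_Ico] at hx
      have h1 := e3.mapsTo hx.1 hx.2
      omega
    · intro x hx
      rw [Finset.mem_insert, Finset.mem_Ico] at hx
      rcases hx with rfl | hx
      · omega
      · have h1 := e3.mapsTo hx.1 hx.2
        omega
    · intro x hx y hy
      rw [Finset.mem_insert, Finset.mem_insert, Finset.mem_Ico] at hx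
      rw [Finset.mem_Ico] at hy
      have h1 := e4.mapsTo hy.1 hy.2
      rcases hx with rfl | rfl | hx
      · omega
      · omega
      · have h2 := e3.mapsTo hx.1 hx.2
        omega

/-- The contribution of a tree at height `h` to the number of decreasing subsequences of length
`q + 1`: a fixed point below `h` arches is the innermost element of `(2h choose q)` of them, and
an arch below `h` arches contributes `(2h choose q) + (2h + 1 choose q)`. -/
def weight (q : ℕ) : ℕ → MotzkinTree → ℕ
  | _, nil => 0
  | h, flat t => (2 * h).choose q + weight q h t
  | h, arch s t => (2 * h).choose q + (2 * h + 1).choose q + weight q (h + 1) s + weight q h t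

/-- Multiplication by `(1 + X) ^ (2 * h)` accounts for `h` arches around the tree: every decreasing
subsequence can be extended by any of their `2h` end points. -/
theorem coeff_one_add_X_pow_mul_poly (q h : ℕ) (t : MotzkinTree) :
    ((1 + X) ^ (2 * h) * (t.poly - 1)).coeff (q + 1) = (weight q h t : ℤ) := by
  induction t generalizing h with
  | nil => simp [poly, weight]
  | flat t ih =>
    have : (1 + X) ^ (2 * h) * ((flat t).poly - 1) =
        (1 + X) ^ (2 * h) * X + (1 + X) ^ (2 * h) * (t.poly - 1) := by
      rw [poly]; ring
    rw [this, coeff_add, ih, coeff_mul_X, coeff_one_add_X_pow, weight]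
    push_cast
    ring
  | arch s t ihs iht =>
    have : (1 + X) ^ (2 * h) * ((arch s t).poly - 1) =
        (1 + X) ^ (2 * h) * X + (1 + X) ^ (2 * h + 1) * X +
          (1 + X) ^ (2 * (h + 1)) * (s.poly - 1) + (1 + X) ^ (2 * h) * (t.poly - 1) := by
      rw [poly]; ring
    rw [this, coeff_add, coeff_add, coeff_add, ihs, iht, coeff_mul_X, coeff_mul_X,
      coeff_one_add_X_pow, coeff_one_add_X_pow, weight]
    push_cast
    ring

theorem coeff_poly (q : ℕ) (t : MotzkinTree) : t.poly.coeff (q + 1) = (weight q 0 t : ℤ) := by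
  rw [← coeff_one_add_X_pow_mul_poly]
  simp [coeff_one]

theorem Encodes.card_fixed {f : ℕ → ℕ} {a : ℕ} {t : MotzkinTree} (h : Encodes f a t) :
    ((Finset.Ico a (a + t.size)).filter fun x => f x = x).card + 2 * t.arches = t.size := by
  induction t generalizing a with
  | nil => simp [size, arches]
  | flat t ih =>
    have e : (Finset.Ico a (a + (flat t).size)).filter (fun x => f x = x) =
        insert a ((Finset.Ico (a + 1) (a + 1 + t.size)).filter fun x => f x = x) := by
      ext x
      simp only [size, Finset.mem_insert, Finset.mem_filter, Finset.mem_Ico]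
      constructor
      · rintro ⟨h1, h2⟩; omega
      · rintro (rfl | h1)
        · exact ⟨by omega, h.1⟩
        · exact ⟨by omega, h1.2⟩
    have := ih h.2
    rw [e, Finset.card_insert_of_notMem (by simp), arches, size]
    omega
  | arch s t ihs iht =>
    obtain ⟨e1, e2, e3, e4⟩ := h
    have e : (Finset.Ico a (a + (arch s t).size)).filter (fun x => f x = x) =
        ((Finset.Ico (a + 1) (a + 1 + s.size)).filter fun x => f x = x) ∪
        ((Finset.Ico (a + s.size + 2) (a + s.size + 2 + t.size)).filter fun x => f x = x) := by
      ext x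
      simp only [Finset.mem_union, Finset.mem_filter, Finset.mem_Ico]
      constructor
      · rintro ⟨h1, h2⟩
        rcases arch_position h1.1 h1.2 with rfl | rfl | h3 | h3
        · omega
        · omega
        · exact Or.inl ⟨h3, h2⟩
        · exact Or.inr ⟨h3, h2⟩
      · simp only [size]
        rintro (h1 | h1) <;> exact ⟨by omega, h1.2⟩
    have h1 := ihs e3
    have h2 := iht e4
    rw [e, Finset.card_union_of_disjoint, arches, size]
    · omega
    · rw [Finset.disjoint_left]
      intro x hx hy
      simp only [Finset.mem_filter, Finset.mem_Ico] at hx hy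
      omega

end MotzkinTree

end DecreasingSubsequences

/-! ### From permutations to Motzkin trees -/

namespace MotzkinTree

open Classical in
/-- The trees of size `n`. -/
noncomputable def ofSize : ℕ → Finset MotzkinTree
  | 0 => {nil}
  | 1 => {flat nil}
  | n + 2 =>
    (ofSize (n + 1)).image flat ∪
      (Finset.HasAntidiagonal.antidiagonal n).attach.biUnion fun p =>
        (ofSize p.1.1 ×ˢ ofSize p.1.2).image fun q => arch q.1 q.2
  decreasing_by
    all_goals first
      | omega
      | (have := Finset.HasAntidiagonal.mem_antidiagonal.mp p.2; omega)

theorem mem_ofSize {n : ℕ} {t : MotzkinTree} : t ∈ ofSize n ↔ t.size = n := by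
  induction n using Nat.strong_induction_on generalizing t with
  | _ n ih =>
    rcases n with _ | _ | n
    · cases t <;> simp [ofSize, size]
    · rcases t with _ | t | ⟨s, t⟩
      · simp [ofSize, size]
      · cases t <;> simp [ofSize, size]
      · simp [ofSize, size]
    · rw [ofSize]
      simp only [Finset.mem_union, Finset.mem_image, Finset.mem_biUnion, Finset.mem_attach,
        true_and, Subtype.exists, Finset.mem_product, Prod.exists,
        Finset.HasAntidiagonal.mem_antidiagonal]
      constructor
      · rintro (⟨t, ht, rfl⟩ | ⟨i, j, hij, s, t, ⟨hs, ht⟩, rfl⟩)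
        · rw [ih _ (by omega)] at ht
          simp [size, ht]
        · rw [ih _ (by omega)] at hs ht
          simp only [size]; omega
      · intro ht
        rcases t with _ | t | ⟨s, t⟩ <;> simp only [size] at ht
        · omega
        · exact Or.inl ⟨t, (ih _ (by omega)).mpr (by omega), rfl⟩
        · exact Or.inr ⟨s.size, t.size, by omega, s, t,
            ⟨(ih _ (by omega)).mpr rfl, (ih _ (by omega)).mpr rfl⟩, rfl⟩

theorem sum_ofSize_zero {M : Type*} [AddCommMonoid M] (F : MotzkinTree → M) :
    ∑ t ∈ ofSize 0, F t = F nil := by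
  simp [ofSize]

theorem sum_ofSize_one {M : Type*} [AddCommMonoid M] (F : MotzkinTree → M) :
    ∑ t ∈ ofSize 1, F t = ∑ t ∈ ofSize 0, F (flat t) := by
  simp [ofSize]

theorem sum_ofSize_add_two {M : Type*} [AddCommMonoid M] (n : ℕ) (F : MotzkinTree → M) :
    ∑ t ∈ ofSize (n + 2), F t = ∑ t ∈ ofSize (n + 1), F (flat t) +
      ∑ p ∈ Finset.HasAntidiagonal.antidiagonal n,
        ∑ s ∈ ofSize p.1, ∑ t ∈ ofSize p.2, F (arch s t) := by
  classical
  rw [ofSize, Finset.sum_union, Finset.sum_image (by simp), Finset.sum_biUnion]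
  · congr 1
    rw [← Finset.sum_attach (Finset.HasAntidiagonal.antidiagonal n)]
    refine Finset.sum_congr rfl fun p _ => ?_
    rw [Finset.sum_image, Finset.sum_product]
    rintro ⟨s, t⟩ _ ⟨s', t'⟩ _ h
    simpa using h
  · rintro ⟨p, hp⟩ _ ⟨q, hq⟩ _ hpq
    simp only [Function.onFun]
    rw [Finset.disjoint_left]
    intro t h1 h2
    simp only [Finset.mem_image, Finset.mem_product, Prod.exists, mem_ofSize] at h1 h2
    obtain ⟨s, t, ⟨h1, h1'⟩, rfl⟩ := h1
    obtain ⟨s', t', ⟨h2, h2'⟩, he⟩ := h2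
    simp only [arch.injEq] at he
    refine hpq (Subtype.ext (Prod.ext ?_ ?_))
    · simp only; rw [← h1, ← h2, he.1]
    · simp only; rw [← h1', ← h2', he.2]
  · rw [Finset.disjoint_left]
    intro t h1 h2
    simp only [Finset.mem_image, Finset.mem_biUnion] at h1 h2
    obtain ⟨t, -, rfl⟩ := h1
    obtain ⟨_, _, _, _, h⟩ := h2
    simp at h

/-- The permutation described by a tree of size `n`. -/
def toPerm {n : ℕ} (t : MotzkinTree) (h : t.size = n) : Equiv.Perm (Fin n) :=
  Function.Involutive.toPerm
    (fun x => ⟨t.toFun 0 x, by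
      have := ((encodes_toFun t 0).mapsTo (x := x) (by omega) (by omega)).2; omega⟩)
    (fun x => Fin.ext ((encodes_toFun t 0).involutive (x := x) (by omega) (by omega)))

end MotzkinTree

/-- A permutation of `Fin n` as a function on the natural numbers, the identity from `n` on. -/
def permFun {n : ℕ} (π : Equiv.Perm (Fin n)) (x : ℕ) : ℕ :=
  if h : x < n then π ⟨x, h⟩ else x

theorem permFun_coe {n : ℕ} (π : Equiv.Perm (Fin n)) (x : Fin n) : permFun π x = π x := by
  simp [permFun]

theorem permFun_lt {n : ℕ} (π : Equiv.Perm (Fin n)) {x : ℕ} (h : x < n) :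
    permFun π x = π ⟨x, h⟩ := by
  simp [permFun, h]

/-- The decreasing subsequences of a permutation, counted by their sets of positions. -/
theorem patternCount_decPerm {n : ℕ} (π : Equiv.Perm (Fin n)) (m : ℕ) :
    patternCount (decPerm m) π =
      {S : Finset ℕ | S ⊆ Finset.range n ∧ StrictAntiOn (permFun π) (S : Set ℕ) ∧
        S.card = m}.ncard := by
  rw [patternCount, ← Set.ncard_coe_finset]
  refine Set.ncard_congr (fun f _ => Finset.univ.image fun a => (f a : ℕ)) ?_ ?_ ?_
  · intro f hf
    simp only [Finset.coe_filter, Finset.mem_univ, true_and, Set.mem_ofPred_eq] at hf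
    refine ⟨?_, ?_, ?_⟩
    · intro x hx
      obtain ⟨a, -, rfl⟩ := Finset.mem_image.mp hx
      exact Finset.mem_range.mpr (f a).2
    · intro x hx y hy hxy
      obtain ⟨a, -, rfl⟩ := Finset.mem_image.mp (Finset.mem_coe.mp hx)
      obtain ⟨b, -, rfl⟩ := Finset.mem_image.mp (Finset.mem_coe.mp hy)
      have hab : a < b := (StrictMono.lt_iff_lt (fun a b => hf.1 a b)).mp hxy
      rw [permFun_coe, permFun_coe]
      exact (hf.2 b a).mpr (Fin.rev_lt_rev.mpr hab)
    · rw [Finset.card_image_of_injective, Finset.card_univ, Fintype.card_fin]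
      exact fun a b hab => (StrictMono.injective fun a b => hf.1 a b) (Fin.ext hab)
  · intro f g hf hg hfg
    simp only [Finset.coe_filter, Finset.mem_univ, true_and, Set.mem_ofPred_eq] at hf hg
    have h : (fun a => (f a : ℕ)) = fun a => (g a : ℕ) :=
      (StrictMono.range_inj (f := fun a => (f a : ℕ)) (g := fun a => (g a : ℕ))
        (fun a b h => hf.1 a b h) (fun a b h => hg.1 a b h)).mp
        (by simpa [← Finset.coe_inj] using hfg)
    exact funext fun a => Fin.ext (congrFun h a)
  · rintro S ⟨hS, hanti, hcard⟩
    have hmem := S.orderEmbOfFin_mem hcard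
    refine ⟨fun a => ⟨S.orderEmbOfFin hcard a, Finset.mem_range.mp (hS (hmem a))⟩, ?_, ?_⟩
    · simp only [Finset.coe_filter, Finset.mem_univ, true_and, Set.mem_ofPred_eq]
      refine ⟨fun a b hab => (S.orderEmbOfFin hcard).strictMono hab, fun a b => ?_⟩
      have := hanti.lt_iff_gt (hmem a) (hmem b)
      rw [permFun_lt π (Finset.mem_range.mp (hS (hmem a))),
        permFun_lt π (Finset.mem_range.mp (hS (hmem b))),
        OrderEmbedding.lt_iff_lt] at this
      exact this.trans Fin.rev_lt_rev.symm
    · rw [← Finset.coe_inj]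
      simp

theorem patternCount_perm3412_eq_zero {n : ℕ} (π : Equiv.Perm (Fin n)) :
    patternCount perm3412 π = 0 ↔ ∀ x y z w : ℕ, x < y → y < z → z < w → w < n →
      ¬ (permFun π z < permFun π w ∧ permFun π w < permFun π x ∧
        permFun π x < permFun π y) := by
  rw [patternCount, Finset.card_eq_zero, Finset.filter_eq_empty_iff]
  constructor
  · intro h x y z w hxy hyz hzw hw ⟨h1, h2, h3⟩
    rw [permFun_lt π (by omega), permFun_lt π (by omega)] at h1 h2 h3
    have e1 : ∀ a b : Fin n, a.1 < b.1 ↔ a < b := fun a b => Iff.rfl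
    rw [e1] at h1 h2 h3
    refine h (Finset.mem_univ
      ![⟨x, by omega⟩, ⟨y, by omega⟩, ⟨z, by omega⟩, ⟨w, by omega⟩]) ⟨?_, ?_⟩
    · intro a b hab
      fin_cases a <;> fin_cases b <;> simp at hab ⊢ <;> omega
    · intro a b
      fin_cases a <;> fin_cases b <;> simp [perm3412] <;> omega
  · rintro h f - ⟨h1, h2⟩
    refine h (f 0) (f 1) (f 2) (f 3) (h1 0 1 (by decide)) (h1 1 2 (by decide))
      (h1 2 3 (by decide)) (f 3).2 ?_
    simp only [permFun_coe]
    exact ⟨(h2 2 3).mpr (by decide), (h2 3 0).mpr (by decide), (h2 0 1).mpr (by decide)⟩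

/-- Each arch contributes a transposition. -/
theorem sign_eq_of_encodes {n : ℕ} {π : Equiv.Perm (Fin n)} {t : MotzkinTree} (hn : t.size = n)
    (h : t.Encodes (permFun π) 0) : Equiv.Perm.sign π = (-1) ^ t.arches := by
  have hsq : π ^ 2 = 1 := by
    ext x
    have := h.involutive (x := x) (by omega) (by omega)
    rw [permFun_coe, permFun_coe] at this
    simpa [pow_two] using this
  have hfix : Fintype.card (Function.fixedPoints π) =
      ((Finset.Ico 0 (0 + t.size)).filter fun x => permFun π x = x).card := by
    rw [Fintype.card_eq_nat_card, Nat.card_coe_set_eq, ← Set.ncard_coe_finset]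
    refine Set.ncard_congr (fun x _ => x) ?_ ?_ ?_
    · intro x hx
      simp only [Finset.coe_filter, Finset.mem_Ico, Set.mem_ofPred_eq, permFun_coe]
      exact ⟨by omega, congrArg Fin.val hx⟩
    · exact fun x y _ _ hxy => Fin.ext hxy
    · intro x hx
      simp only [Finset.coe_filter, Finset.mem_Ico, Set.mem_ofPred_eq] at hx
      have hxn : x < n := by omega
      refine ⟨⟨x, hxn⟩, ?_, rfl⟩
      rw [permFun_lt π hxn] at hx
      exact Fin.ext hx.2
  have hcard := h.card_fixed
  rw [Equiv.Perm.sign_of_pow_two_eq_one hsq, hfix, Fintype.card_fin]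
  congr 1
  omega

theorem encodes_permFun_toPerm {n : ℕ} (t : MotzkinTree) (h : t.size = n) :
    t.Encodes (permFun (t.toPerm h)) 0 := by
  refine (t.encodes_toFun 0).congr fun x h1 h2 => ?_
  rw [permFun_lt _ (by omega : x < n)]
  rfl

theorem mem_involutionsWith_iff {n : ℕ} (q r : ℕ) {π : Equiv.Perm (Fin n)} {t : MotzkinTree}
    (hn : t.size = n) (h : t.Encodes (permFun π) 0) :
    π ∈ involutionsWith (q + 1) r n ↔ t.weight q 0 = r := by
  have h1 : ∀ j, π (π j) = j := fun j => by
    have := h.involutive (x := j) (by omega) (by omega)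
    rw [permFun_coe, permFun_coe] at this
    exact Fin.ext this
  have h2 : patternCount perm3412 π = 0 := by
    rw [patternCount_perm3412_eq_zero]
    intro x y z w hxy hyz hzw hw
    exact h.avoids (by omega) hxy hyz hzw (by omega)
  have h3 : patternCount (decPerm (q + 1)) π = t.weight q 0 := by
    have e := t.coeff_poly q
    rw [← h.decreasingPoly_eq, coeff_decreasingPoly, zero_add, ← Finset.range_eq_Ico, hn] at e
    rw [patternCount_decPerm]
    exact_mod_cast e
  simp [involutionsWith, h1, h2, h3]

theorem coeff_signedGF (q r n : ℕ) :
    PowerSeries.coeff n (signedGF (q + 1) r) =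
      ∑ t ∈ MotzkinTree.ofSize n, if t.weight q 0 = r then (-1 : ℂ) ^ t.arches else 0 := by
  rw [signedGF, PowerSeries.coeff_mk, ← Finset.sum_filter]
  symm
  have key : ∀ t ∈ MotzkinTree.ofSize n, t.size = n := fun t => MotzkinTree.mem_ofSize.mp
  refine Finset.sum_bij (fun t ht => t.toPerm (key t (Finset.mem_filter.mp ht).1)) ?_ ?_ ?_ ?_
  · intro t ht
    rw [mem_involutionsWith_iff q r _ (encodes_permFun_toPerm t _)]
    · exact (Finset.mem_filter.mp ht).2
    · exact key t (Finset.mem_filter.mp ht).1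
  · intro t ht t' ht' h
    have hs := key t (Finset.mem_filter.mp ht).1
    have hs' := key t' (Finset.mem_filter.mp ht').1
    refine (encodes_permFun_toPerm t hs).unique ?_ (hs.trans hs'.symm)
    rw [h]
    exact encodes_permFun_toPerm t' hs'
  · intro π hπ
    obtain ⟨h1, h2, h3⟩ : (∀ j, π (π j) = j) ∧ patternCount perm3412 π = 0 ∧
        patternCount (decPerm (q + 1)) π = r := by simpa [involutionsWith] using hπ
    obtain ⟨t, ht, het⟩ := MotzkinTree.exists_encodes (f := permFun π) n (a := 0)
      (fun x _ hx => by
        rw [permFun_lt π (by omega : x < n)]; omega)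
      (fun x _ hx => by
        rw [permFun_lt π (by omega : x < n), permFun_coe, h1])
      (fun x y z w _ hxy hyz hzw hw =>
        (patternCount_perm3412_eq_zero π).mp h2 x y z w hxy hyz hzw (by omega))
    refine ⟨t, ?_, ?_⟩
    · rw [Finset.mem_filter, MotzkinTree.mem_ofSize]
      exact ⟨ht, (mem_involutionsWith_iff q r ht het).mp hπ⟩
    · ext x
      have := (encodes_permFun_toPerm t ht).eqOn het (x := x) (by omega) (by omega)
      rwa [permFun_coe, permFun_coe] at this
  · intro t ht
    rw [sign_eq_of_encodes (key t (Finset.mem_filter.mp ht).1) (encodes_permFun_toPerm t _)]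
    simp

/-! ### The generating functions by height -/

section HeightGF

open PowerSeries Finset.HasAntidiagonal

/-- Exchange of the two variables of an iterated power series. -/
noncomputable def swapVars (R : Type*) [CommRing R] : R⟦X⟧⟦X⟧ →+* R⟦X⟧⟦X⟧ where
  toFun F := mk fun r => mk fun n => coeff r (coeff n F)
  map_zero' := by ext; simp
  map_add' F G := by ext; simp
  map_one' := by
    ext r n
    simp only [coeff_mk, coeff_one, apply_ite (coeff r), apply_ite (coeff n), map_zero]
    split_ifs <;> simp_all
  map_mul' F G := by
    ext r n
    simp only [coeff_mk, coeff_mul, map_sum]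
    exact Finset.sum_comm

theorem coeff_coeff_swapVars {R : Type*} [CommRing R] (F : R⟦X⟧⟦X⟧) (r n : ℕ) :
    coeff n (coeff r (swapVars R F)) = coeff r (coeff n F) := by
  simp [swapVars]

theorem swapVars_X {R : Type*} [CommRing R] : swapVars R X = C X := by
  ext r n
  rw [coeff_coeff_swapVars, coeff_X, coeff_C]
  split_ifs with h1 h2 h2 <;> simp_all [coeff_X, coeff_one]

theorem swapVars_C_X {R : Type*} [CommRing R] : swapVars R (C X) = X := by
  ext r n
  rw [coeff_coeff_swapVars, coeff_X, coeff_C]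
  split_ifs with h1 h2 h2 <;> simp_all [coeff_X, coeff_one]

namespace MotzkinTree

/-- The signed generating function of the trees at height `h`: the outer variable marks the size,
the inner one marks the weight. -/
noncomputable def sizeGF (q h : ℕ) : ℂ⟦X⟧⟦X⟧ :=
  mk fun n => ∑ t ∈ ofSize n, (-1 : ℂ⟦X⟧) ^ t.arches * X ^ t.weight q h

/-- A tree is empty, starts with a level step, or starts with an arch, which raises the height of
the enclosed tree by one and reverses the sign. -/
theorem sizeGF_eq (q h : ℕ) :
    sizeGF q h = 1 + X * (C X ^ ((2 * h).choose q) * sizeGF q h) -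
      X ^ 2 * (C X ^ ((2 * h).choose q + (2 * h + 1).choose q) *
        (sizeGF q (h + 1) * sizeGF q h)) := by
  ext1 n
  rcases n with _ | _ | n
  · simp [sizeGF, sum_ofSize_zero, arches, weight]
  · rw [map_sub, map_add, coeff_succ_X_mul, coeff_X_pow_mul', ← map_pow, coeff_C_mul]
    simp only [sizeGF, coeff_mk, sum_ofSize_one, zero_add, sum_ofSize_zero, arches, weight]
    simp [coeff_one]
  · rw [map_sub, map_add, coeff_succ_X_mul, ← map_pow, ← map_pow, coeff_C_mul,
      show n + 1 + 1 = n + 2 from rfl, coeff_X_pow_mul,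
      coeff_C_mul, coeff_mul]
    simp only [sizeGF, coeff_mk]
    rw [sum_ofSize_add_two]
    simp only [arches, weight, Finset.sum_mul_sum]
    rw [coeff_one, if_neg (by omega), zero_add, sub_eq_add_neg, Finset.mul_sum, Finset.mul_sum,
      ← Finset.sum_neg_distrib]
    congr 1
    · refine Finset.sum_congr rfl fun t _ => ?_
      ring
    · refine Finset.sum_congr rfl fun p _ => ?_
      rw [Finset.mul_sum, ← Finset.sum_neg_distrib]
      refine Finset.sum_congr rfl fun s _ => ?_
      rw [Finset.mul_sum, ← Finset.sum_neg_distrib]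
      refine Finset.sum_congr rfl fun t _ => ?_
      ring

/-- The signed generating function of the trees at height `h`, as a power series in a variable
which marks the weight, with coefficients in the field of Laurent series in a variable which marks
the size. -/
noncomputable def weightGF (q h : ℕ) : (LaurentSeries ℂ)⟦X⟧ :=
  PowerSeries.map (HahnSeries.ofPowerSeries ℤ ℂ) (swapVars ℂ (sizeGF q h))

/-- The functional equation of the generating function by height, in the form of a continued
fraction. -/
theorem weightGF_mul (q h : ℕ) :
    weightGF q h * (1 - C xL * X ^ ((2 * h).choose q) -
      C (-xL ^ 2) * X ^ ((2 * h).choose q + (2 * h + 1).choose q) * weightGF q (h + 1)) = 1 := by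
  have h1 := congrArg (PowerSeries.map (HahnSeries.ofPowerSeries ℤ ℂ))
    (congrArg (swapVars ℂ) (sizeGF_eq q h))
  have h2 : HahnSeries.ofPowerSeries ℤ ℂ X = xL := HahnSeries.ofPowerSeries_X
  simp only [map_sub, map_add, map_mul, map_pow, map_one, swapVars_X, swapVars_C_X,
    PowerSeries.map_X, PowerSeries.map_C, h2] at h1
  change weightGF q h = 1 + C xL * (X ^ _ * weightGF q h) -
    C xL ^ 2 * (X ^ _ * (weightGF q (h + 1) * weightGF q h)) at h1
  rw [map_neg, map_pow]
  linear_combination h1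

end MotzkinTree

theorem coe_signedGF (q r : ℕ) :
    (signedGF (q + 1) r : LaurentSeries ℂ) = coeff r (MotzkinTree.weightGF q 0) := by
  rw [MotzkinTree.weightGF, coeff_map]
  congr 1
  ext n
  rw [coeff_signedGF, coeff_coeff_swapVars, MotzkinTree.sizeGF, coeff_mk, map_sum]
  refine Finset.sum_congr rfl fun t _ => ?_
  have : (-1 : ℂ⟦X⟧) ^ t.arches = C ((-1) ^ t.arches) := by simp
  rw [this, coeff_C_mul, coeff_X_pow]
  split_ifs <;> simp_all

end HeightGF

/-! ### Coefficients of continued fractions -/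

/-- The number of words with `q` letters of one kind and `l` letters of another kind which are
cut into `p` pieces. -/
def distributions (p q l : ℕ) : ℕ :=
  (p + q + l - 1).choose (q + l) * (q + l).choose l

/-- The number of ways to distribute `l s` fixed points and `D (s + 1)` arches at each level `s`
among the `D s` arches which enclose that level. -/
def chainCoeff {b : ℕ} (D : Fin (b + 1) → ℕ) (l : Fin b → ℕ) : ℕ :=
  ∏ s, distributions (D s.castSucc) (D s.succ) (l s)

theorem chainCoeff_cons {b : ℕ} (p : ℕ) (D : Fin (b + 1) → ℕ) (l₀ : ℕ) (l : Fin b → ℕ) :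
    chainCoeff (Fin.cons p D : Fin (b + 2) → ℕ) (Fin.cons l₀ l : Fin (b + 1) → ℕ) =
      distributions p (D 0) l₀ * chainCoeff D l := by
  simp [chainCoeff, Fin.prod_univ_succ]

theorem Fintype.sum_fin_succ_fun {M α : Type*} [AddCommMonoid M] [Fintype α] {b : ℕ}
    (F : (Fin (b + 1) → α) → M) :
    ∑ d : Fin (b + 1) → α, F d = ∑ x : α, ∑ d : Fin b → α, F (Fin.cons x d) := by
  rw [← (Fin.consEquiv fun _ => α).sum_comp, Fintype.sum_prod_type]
  rfl

section ContinuedFraction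

open PowerSeries

variable {K : Type*} [Field K]

/-- The binomial series of `(1 - A) ^ (-p)`. -/
theorem dvd_pow_sub_binomial_sum {H A : K⟦X⟧} (hH : H * (1 - A) = 1) (hA : X ∣ A) (p M : ℕ) :
    X ^ (M + 1) ∣ H ^ p - ∑ N ∈ Finset.range (M + 1), ((p + N - 1).choose N : K⟦X⟧) * A ^ N := by
  induction p with
  | zero =>
    rw [Finset.sum_eq_single_of_mem 0 (by simp)]
    · simp
    · intro N _ hN
      rw [Nat.choose_eq_zero_of_lt (by omega)]
      simp
  | succ p ih =>
    have key : ∀ M : ℕ,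
        (∑ N ∈ Finset.range (M + 1), ((p + 1 + N - 1).choose N : K⟦X⟧) * A ^ N) * (1 - A) =
          ∑ N ∈ Finset.range (M + 1), ((p + N - 1).choose N : K⟦X⟧) * A ^ N -
            ((p + M).choose M : K⟦X⟧) * A ^ (M + 1) := by
      intro M
      induction M with
      | zero => simp
      | succ M ihM =>
        rw [Finset.sum_range_succ, add_mul, ihM, Finset.sum_range_succ _ (M + 1),
          show p + 1 + (M + 1) - 1 = p + M + 1 by omega, show p + (M + 1) - 1 = p + M by omega,
          show p + (M + 1) = p + M + 1 by omega, Nat.choose_succ_succ (p + M) M]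
        push_cast
        ring
    have e : H ^ (p + 1) -
        ∑ N ∈ Finset.range (M + 1), ((p + 1 + N - 1).choose N : K⟦X⟧) * A ^ N =
          H * (H ^ p - ∑ N ∈ Finset.range (M + 1), ((p + N - 1).choose N : K⟦X⟧) * A ^ N) +
            H * ((p + M).choose M : K⟦X⟧) * A ^ (M + 1) := by
      linear_combination (∑ N ∈ Finset.range (M + 1),
        ((p + 1 + N - 1).choose N : K⟦X⟧) * A ^ N) * hH - H * key M
    rw [e]
    exact dvd_add (ih.mul_left _) ((pow_dvd_pow_of_dvd hA _).mul_left _)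

theorem coeff_eq_of_dvd_sub {F G : K⟦X⟧} {M s : ℕ} (h : X ^ (M + 1) ∣ F - G) (hs : s ≤ M) :
    coeff s F = coeff s G := by
  have := X_pow_dvd_iff.mp h s (by omega)
  rwa [map_sub, sub_eq_zero] at this

theorem coeff_pow_eq_binomial_sum {H A : K⟦X⟧} (hH : H * (1 - A) = 1) (hA : X ∣ A) (p : ℕ)
    {s R : ℕ} (hs : s ≤ R) :
    coeff s (H ^ p) = ∑ N ∈ Finset.range (R + 1), ((p + N - 1).choose N : K) * coeff s (A ^ N) := by
  rw [coeff_eq_of_dvd_sub (dvd_pow_sub_binomial_sum hH hA p R) hs, map_sum]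
  refine Finset.sum_congr rfl fun N _ => ?_
  rw [show ((p + N - 1).choose N : K⟦X⟧) = C ((p + N - 1).choose N : K) by simp, coeff_C_mul]

/-- A sum over the pairs of natural numbers arranged by antidiagonals, if the summand vanishes
beyond one of them. -/
theorem sum_range_antidiagonal {M : Type*} [AddCommMonoid M] (R : ℕ) (F : ℕ × ℕ → M)
    (hF : ∀ x : ℕ × ℕ, R < x.1 + x.2 → F x = 0) :
    ∑ N ∈ Finset.range (R + 1), ∑ x ∈ Finset.HasAntidiagonal.antidiagonal N, F x =
      ∑ d : Fin (R + 1), ∑ l : Fin (R + 1), F (l, d) := by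
  rw [← Finset.sum_range fun d => ∑ l : Fin (R + 1), F (l, d)]
  simp_rw [fun d => (Finset.sum_range (n := R + 1) fun l => F (l, d)).symm]
  rw [Finset.sum_comm, ← Finset.sum_product (f := F),
    ← Finset.sum_filter_add_sum_filter_not
      (Finset.range (R + 1) ×ˢ Finset.range (R + 1)) fun x : ℕ × ℕ => x.1 + x.2 ≤ R]
  rw [Finset.sum_eq_zero (s := Finset.filter (fun x : ℕ × ℕ => ¬ x.1 + x.2 ≤ R) _), add_zero]
  · refine Eq.trans ?_ (Finset.sum_fiberwise_of_maps_to (t := Finset.range (R + 1))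
      (g := fun x : ℕ × ℕ => x.1 + x.2) ?_ F)
    · refine Finset.sum_congr rfl fun N hN => Finset.sum_congr ?_ fun _ _ => rfl
      ext x
      simp only [Finset.mem_range] at hN
      simp only [Finset.HasAntidiagonal.mem_antidiagonal, Finset.mem_filter, Finset.mem_product,
        Finset.mem_range]
      omega
    · intro x hx
      simp only [Finset.mem_filter, Finset.mem_range] at hx ⊢
      omega
  · intro x hx
    refine hF x ?_
    have := (Finset.mem_filter.mp hx).2
    omega

/-- One level of a continued fraction: in the binomial series of
`(1 - a X ^ c - a' X ^ e G) ^ (-p)`, the term with `l` factors of the first kind and `d` factors of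
the second kind occurs `distributions p d l` times. -/
theorem coeff_pow_of_mul_eq_one {H G : K⟦X⟧} {a a' : K} {c e : ℕ} (hc : 0 < c) (he : 0 < e)
    (hH : H * (1 - C a * X ^ c - C a' * X ^ e * G) = 1) (p : ℕ) {s R : ℕ} (hs : s ≤ R) :
    coeff s (H ^ p) = ∑ d : Fin (R + 1), ∑ l : Fin (R + 1),
      if d * e + l * c ≤ s then
        (distributions p d l : K) * (a ^ (l : ℕ) * a' ^ (d : ℕ)) *
          coeff (s - (d * e + l * c)) (G ^ (d : ℕ))
      else 0 := by
  have hA : X ∣ C a * X ^ c + C a' * X ^ e * G :=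
    dvd_add ((dvd_pow_self X hc.ne').mul_left _)
      (((dvd_pow_self X he.ne').mul_left _).mul_right _)
  rw [coeff_pow_eq_binomial_sum (A := C a * X ^ c + C a' * X ^ e * G) (by rwa [← sub_sub]) hA p hs,
    ← sum_range_antidiagonal R fun x => if x.2 * e + x.1 * c ≤ s then
        (distributions p x.2 x.1 : K) * (a ^ x.1 * a' ^ x.2) *
          coeff (s - (x.2 * e + x.1 * c)) (G ^ x.2) else 0]
  · refine Finset.sum_congr rfl fun N _ => ?_
    rw [(Commute.all _ _).add_pow', map_sum, Finset.mul_sum]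
    refine Finset.sum_congr rfl fun x hx => ?_
    obtain ⟨l, d⟩ := x
    obtain rfl : l + d = N := Finset.HasAntidiagonal.mem_antidiagonal.mp hx
    have : (C a * X ^ c : K⟦X⟧) ^ l * (C a' * X ^ e * G) ^ d =
        X ^ (d * e + l * c) * (C (a ^ l * a' ^ d) * G ^ d) := by
      rw [map_mul, map_pow, map_pow, pow_add, pow_mul', pow_mul']
      ring
    rw [this, map_nsmul, coeff_X_pow_mul', coeff_C_mul, distributions,
      show p + d + l = p + (l + d) by omega, Nat.add_comm d l]
    split_ifs
    · rw [nsmul_eq_mul]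
      push_cast
      ring
    · simp
  · rintro ⟨l, d⟩ h
    simp only at h
    rw [if_neg]
    have h1 : d ≤ d * e := Nat.le_mul_of_pos_right d he
    have h2 : l ≤ l * c := Nat.le_mul_of_pos_right l hc
    simp only
    omega

/-- The coefficients of the powers of a continued fraction with `b` relevant levels, up to degree
`R`. Since all marks are positive, entries of `d` and `l` above `R` cannot occur. -/
theorem coeff_pow_continuedFraction {R : ℕ} (b : ℕ) {G : ℕ → K⟦X⟧} {a a' : ℕ → K} {c e : ℕ → ℕ}
    (hc : ∀ h < b, 0 < c h) (he : ∀ h < b, 0 < e h)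
    (hG : ∀ h < b, G h * (1 - C (a h) * X ^ c h - C (a' h) * X ^ e h * G (h + 1)) = 1)
    (hb : X ^ (R + 1) ∣ G b - 1) (p : ℕ) {s : ℕ} (hs : s ≤ R) :
    coeff s (G 0 ^ p) = ∑ d : Fin b → Fin (R + 1), ∑ l : Fin b → Fin (R + 1),
      if ∑ j, (d j : ℕ) * e j + ∑ j, (l j : ℕ) * c j = s then
        (chainCoeff (Fin.cons p fun j => (d j : ℕ) : Fin (b + 1) → ℕ) (fun j => (l j : ℕ)) : K) *
          ∏ j : Fin b, a j ^ (l j : ℕ) * a' j ^ (d j : ℕ)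
      else 0 := by
  induction b generalizing G a a' c e p s with
  | zero =>
    have h : X ^ (R + 1) ∣ G 0 ^ p - 1 := hb.trans (sub_one_dvd_pow_sub_one _ _)
    rw [coeff_eq_of_dvd_sub h hs, coeff_one]
    simp [chainCoeff, eq_comm]
  | succ b ih =>
    rw [coeff_pow_of_mul_eq_one (hc 0 (by omega)) (he 0 (by omega)) (hG 0 (by omega)) p hs,
      Fintype.sum_fin_succ_fun]
    refine Finset.sum_congr rfl fun d₀ _ => ?_
    simp_rw [Fintype.sum_fin_succ_fun (α := Fin (R + 1)) (b := b)
      (F := fun l => ite (_ + ∑ j, (l j : ℕ) * c j = s) _ _)]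
    rw [Finset.sum_comm]
    refine Finset.sum_congr rfl fun l₀ _ => ?_
    split_ifs with hle
    · rw [zero_add, ih (G := fun h => G (h + 1)) (a := fun h => a (h + 1))
        (a' := fun h => a' (h + 1)) (c := fun h => c (h + 1)) (e := fun h => e (h + 1))
        (fun h hh => hc _ (by omega)) (fun h hh => he _ (by omega))
        (fun h hh => hG _ (by omega)) hb d₀ (s := s - (d₀ * e 0 + l₀ * c 0)) (by omega),
        Finset.mul_sum]
      refine Finset.sum_congr rfl fun d _ => ?_
      rw [Finset.mul_sum]
      refine Finset.sum_congr rfl fun l _ => ?_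
      have h1 : (fun j => ((Fin.cons d₀ d : Fin (b + 1) → Fin (R + 1)) j : ℕ)) =
          Fin.cons (d₀ : ℕ) fun j => (d j : ℕ) := by
        ext j; cases j using Fin.cases <;> simp
      have h2 : (fun j => ((Fin.cons l₀ l : Fin (b + 1) → Fin (R + 1)) j : ℕ)) =
          Fin.cons (l₀ : ℕ) fun j => (l j : ℕ) := by
        ext j; cases j using Fin.cases <;> simp
      rw [h1, h2, chainCoeff_cons, Fin.cons_zero]
      simp only [Fin.sum_univ_succ, Fin.prod_univ_succ, Fin.cons_zero, Fin.cons_succ,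
        Fin.val_zero, Fin.val_succ]
      rw [mul_ite, mul_zero]
      refine if_congr (by omega) ?_ rfl
      push_cast
      ring
    · symm
      refine Finset.sum_eq_zero fun d _ => Finset.sum_eq_zero fun l _ => if_neg ?_
      simp only [Fin.sum_univ_succ, Fin.cons_zero, Fin.cons_succ, Fin.val_zero]
      omega

end ContinuedFraction

/-! ### The unmarked levels -/

section Convergents

open PowerSeries

variable {K : Type*} [Field K]

/-- The denominators of the convergents of the continued fraction with all levels equal to
`1 - x + x² / ⋯`, preceded by `0`. -/
def convergentDen (x : K) : ℕ → K
  | 0 => 0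
  | 1 => 1
  | n + 2 => (1 - x) * convergentDen x (n + 1) + x ^ 2 * convergentDen x n

/-- A continued fraction whose lower `n` levels are unmarked is a quotient of two expressions
which are linear in the remaining part `Y`. -/
theorem convergent_mul (x : K) (n : ℕ) {G : ℕ → K⟦X⟧} {Y : K⟦X⟧}
    (hG : ∀ h < n, G h * (1 - C x + C (x ^ 2) * G (h + 1)) = 1) (hY : G n * (1 - C x - Y) = 1) :
    G 0 * (C (convergentDen x (n + 2)) - Y * C (convergentDen x (n + 1))) =
      C (convergentDen x (n + 1)) - Y * C (convergentDen x n) := by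
  induction n generalizing Y with
  | zero =>
    simp only [convergentDen, map_zero, map_one, mul_one, mul_zero, add_zero, map_sub]
    linear_combination hY
  | succ n ih =>
    have h1 := ih (Y := -(C (x ^ 2) * G (n + 1))) (fun h hh => hG h (by omega))
      (by rw [sub_neg_eq_add]; exact hG n (by omega))
    change G 0 * (C ((1 - x) * convergentDen x (n + 2) + x ^ 2 * convergentDen x (n + 1)) -
      Y * C (convergentDen x (n + 2))) =
        C (convergentDen x (n + 2)) - Y * C (convergentDen x (n + 1))
    have e : (C (convergentDen x (n + 2)) : K⟦X⟧) = (1 - C x) * C (convergentDen x (n + 1)) +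
        C (x ^ 2) * C (convergentDen x n) := by
      rw [convergentDen]; simp
    simp only [map_add, map_sub, map_mul, map_one]
    rw [e] at h1 ⊢
    linear_combination (1 - C x - Y) * h1 - (G 0 * C (x ^ 2) * C (convergentDen x (n + 1)) -
      C (x ^ 2) * C (convergentDen x n)) * hY

/-- The determinant identity for consecutive convergents. -/
theorem convergentDen_sq_sub (x : K) (n : ℕ) :
    convergentDen x (n + 1) ^ 2 - convergentDen x n * convergentDen x (n + 2) = (-x ^ 2) ^ n := by
  induction n with
  | zero => simp [convergentDen]
  | succ n ih =>
    rw [pow_succ (-x ^ 2), ← ih, convergentDen.eq_3 x (n + 1), convergentDen.eq_3 x n]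
    ring

/-- The quotient `(A - z F) / (B - z E)` is a constant plus a multiple of a geometric series. -/
theorem coeff_of_mul_linear_eq {A B E F : K} (hB : B ≠ 0) (hE : E ≠ 0) {G H z : K⟦X⟧}
    (hG : G * (C B - z * C E) = C A - z * C F) (hH : H * (1 - C (E / B) * z) = 1) {r : ℕ}
    (hr : 1 ≤ r) : coeff r G = (A * E - F * B) / (E * B) * coeff r H := by
  have h1 : G * (1 - C (E / B) * z) = C (A / B) - C (F / B) * z := by
    have e1 : (C B : K⟦X⟧) * C B⁻¹ = 1 := by rw [← map_mul, mul_inv_cancel₀ hB, map_one]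
    simp only [div_eq_mul_inv, map_mul]
    linear_combination C B⁻¹ * hG - G * e1
  have h2 : G = C (F / E) + C ((A * E - F * B) / (E * B)) * H := by
    have e1 : (C (F / E) : K⟦X⟧) * C (E / B) = C (F / B) := by
      rw [← map_mul]; congr 1; field_simp
    have e2 : (C ((A * E - F * B) / (E * B)) : K⟦X⟧) = C (A / B) - C (F / E) := by
      rw [← map_sub]; congr 1; field_simp
    rw [e2]
    linear_combination H * h1 - (G - C (F / E)) * hH + H * z * e1
  have h3 := congrArg (coeff r) h2
  rwa [map_add, coeff_C, if_neg (by omega), zero_add, coeff_C_mul] at h3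

/-- A level whose marks exceed `R` does not matter up to degree `R`. -/
theorem dvd_sub_one_of_mul_eq_one {H G : K⟦X⟧} {a a' : K} {c e R : ℕ} (hc : R < c) (he : R < e)
    (hH : H * (1 - C a * X ^ c - C a' * X ^ e * G) = 1) : X ^ (R + 1) ∣ H - 1 := by
  have : H - 1 = H * (C a * X ^ c + C a' * X ^ e * G) := by linear_combination hH
  rw [this]
  exact (dvd_add ((pow_dvd_pow X hc).mul_left _)
    (((pow_dvd_pow X he).mul_left _).mul_right _)).mul_left _

theorem exists_mul_one_sub_eq_one {A : K⟦X⟧} (hA : X ∣ A) : ∃ H : K⟦X⟧, H * (1 - A) = 1 := by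
  refine ⟨(1 - A)⁻¹, PowerSeries.inv_mul_cancel _ ?_⟩
  rw [map_sub, X_dvd_iff.mp hA]
  simp

end Convergents

/-! ### Chebyshev polynomials -/

theorem xL_ne_zero : xL ≠ 0 := HahnSeries.single_ne_zero one_ne_zero

theorem iL_sq : iL ^ 2 = -1 := by
  rw [iL, ← map_pow, Complex.I_sq]
  simp

theorem iL_ne_zero : iL ≠ 0 := fun h => by
  have := iL_sq
  rw [h] at this
  norm_num at this

theorem two_ne_zero_laurent : (2 : LaurentSeries ℂ) ≠ 0 := fun h => by
  have : (HahnSeries.C (2 : ℂ) : LaurentSeries ℂ) = HahnSeries.C 0 := by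
    rw [map_ofNat, map_zero, h]
  exact two_ne_zero (HahnSeries.C_injective this)

/-- The denominators of the convergents are rescaled Chebyshev polynomials. -/
theorem convergentDen_eq_W (n : ℕ) : convergentDen xL (n + 1) = (iL * xL) ^ n * W n := by
  induction n using Nat.strong_induction_on with
  | _ n ih =>
    rcases n with _ | _ | n
    · simp [convergentDen, W]
    · have := iL_ne_zero
      have := xL_ne_zero
      have := two_ne_zero_laurent
      simp [convergentDen, W]
      field_simp
    · have h1 := ih (n + 1) (by omega)
      have h2 := ih n (by omega)
      have h3 : W (n + 2) = (1 - xL) / (iL * xL) * W (n + 1) - W n := by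
        have e : ((n + 2 : ℕ) : ℤ) = (n : ℤ) + 2 := by push_cast; ring
        have e' : ((n + 1 : ℕ) : ℤ) = (n : ℤ) + 1 := by push_cast; ring
        rw [W, e, Polynomial.Chebyshev.U_add_two, W, W, e']
        simp only [Polynomial.eval_sub, Polynomial.eval_mul, Polynomial.eval_X,
          Polynomial.eval_ofNat]
        have := two_ne_zero_laurent
        congr 2
        field_simp
      rw [convergentDen, h1, h2, h3]
      have hi := iL_ne_zero
      have hx := xL_ne_zero
      have h4 : (iL * xL) ^ (n + 2) * ((1 - xL) / (iL * xL)) = (iL * xL) ^ (n + 1) * (1 - xL) := by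
        rw [pow_succ, mul_assoc, mul_div_cancel₀ _ (mul_ne_zero hi hx)]
      linear_combination (-W (n + 1)) * h4 + (iL * xL) ^ n * W n * xL ^ 2 * iL_sq

/-- The denominators of the convergents are power series with constant term `1`, hence units. -/
theorem exists_convergentDen_eq (n : ℕ) :
    ∃ F : PowerSeries ℂ, PowerSeries.constantCoeff F = 1 ∧
      convergentDen xL (n + 1) = HahnSeries.ofPowerSeries ℤ ℂ F := by
  have hX : HahnSeries.ofPowerSeries ℤ ℂ PowerSeries.X = xL := HahnSeries.ofPowerSeries_X
  induction n using Nat.strong_induction_on with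
  | _ n ih =>
    rcases n with _ | _ | n
    · exact ⟨1, by simp, by simp [convergentDen]⟩
    · exact ⟨1 - PowerSeries.X, by simp, by simp [convergentDen, hX]⟩
    · obtain ⟨F, hF, hF'⟩ := ih (n + 1) (by omega)
      obtain ⟨F', -, hF''⟩ := ih n (by omega)
      refine ⟨(1 - PowerSeries.X) * F + PowerSeries.X ^ 2 * F', by simp [hF], ?_⟩
      rw [convergentDen, hF', hF'']
      simp [hX]

theorem ofPowerSeries_ne_zero {F : PowerSeries ℂ} (hF : PowerSeries.constantCoeff F = 1) :
    HahnSeries.ofPowerSeries ℤ ℂ F ≠ 0 := by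
  intro h
  have : F = 0 := HahnSeries.ofPowerSeries_injective (h.trans (map_zero _).symm)
  simp [this] at hF

theorem convergentDen_ne_zero (n : ℕ) : convergentDen xL (n + 1) ≠ 0 := by
  obtain ⟨F, hF, h⟩ := exists_convergentDen_eq n
  rw [h]
  exact ofPowerSeries_ne_zero hF

theorem convergentDen_add_ne_zero (n : ℕ) :
    convergentDen xL (n + 2) + xL * convergentDen xL (n + 1) ≠ 0 := by
  obtain ⟨F, hF, h⟩ := exists_convergentDen_eq (n + 1)
  obtain ⟨F', -, h'⟩ := exists_convergentDen_eq n
  have hX : HahnSeries.ofPowerSeries ℤ ℂ PowerSeries.X = xL := HahnSeries.ofPowerSeries_X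
  rw [h, h', ← hX, ← map_mul, ← map_add]
  exact ofPowerSeries_ne_zero (by simp [hF])

theorem W_ne_zero (n : ℕ) : W n ≠ 0 := fun h => convergentDen_ne_zero n (by
  rw [convergentDen_eq_W, h, mul_zero])

theorem convergentDen_add_eq_W (n : ℕ) :
    convergentDen xL (n + 2) + xL * convergentDen xL (n + 1) =
      (iL * xL) ^ (n + 1) * (W (n + 1) - iL * W n) := by
  rw [convergentDen_eq_W, convergentDen_eq_W]
  linear_combination ((iL * xL) ^ n * xL * W n) * iL_sq

theorem W_sub_ne_zero (n : ℕ) : W (n + 1) - iL * W n ≠ 0 := fun h =>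
  convergentDen_add_ne_zero n (by rw [convergentDen_add_eq_W, h, mul_zero])

/-! ### The marked levels and the resulting formulas -/

theorem Fintype.sum_fin_succ_fun_snoc {M α : Type*} [AddCommMonoid M] [Fintype α] {b : ℕ}
    (F : (Fin (b + 1) → α) → M) :
    ∑ d : Fin (b + 1) → α, F d = ∑ x : α, ∑ d : Fin b → α, F (Fin.snoc d x) := by
  rw [← (Fin.snocEquiv fun _ => α).sum_comp, Fintype.sum_prod_type]
  rfl

theorem Fin.val_comp_cons {R n : ℕ} (x : Fin (R + 1)) (d : Fin n → Fin (R + 1)) :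
    (fun j => ((Fin.cons x d : Fin (n + 1) → Fin (R + 1)) j : ℕ)) =
      Fin.cons (x : ℕ) fun j => (d j : ℕ) := by
  ext j
  cases j using Fin.cases <;> simp

theorem Fin.val_comp_snoc {R n : ℕ} (x : Fin (R + 1)) (d : Fin n → Fin (R + 1)) :
    (fun j => ((Fin.snoc d x : Fin (n + 1) → Fin (R + 1)) j : ℕ)) =
      Fin.snoc (fun j => (d j : ℕ)) (x : ℕ) := by
  ext j
  cases j using Fin.lastCases <;> simp

open Classical in
/-- A set of pairs of sequences with entries at most `R` is finite, and a sum over it is a sum over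
pairs of sequences in `{0, …, R}`. -/
theorem finite_and_finsum_mem_eq {M : Type*} [AddCommMonoid M] {n R : ℕ}
    {S : Set ((Fin n → ℕ) × (Fin n → ℕ))} (hS : ∀ p ∈ S, ∀ j, p.1 j ≤ R ∧ p.2 j ≤ R)
    (f : (Fin n → ℕ) × (Fin n → ℕ) → M) :
    S.Finite ∧ ∑ᶠ p ∈ S, f p = ∑ d : Fin n → Fin (R + 1), ∑ l : Fin n → Fin (R + 1),
      if (fun j => (d j : ℕ), fun j => (l j : ℕ)) ∈ S then
        f (fun j => (d j : ℕ), fun j => (l j : ℕ)) else 0 := by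
  let φ : (Fin n → Fin (R + 1)) × (Fin n → Fin (R + 1)) → (Fin n → ℕ) × (Fin n → ℕ) :=
    fun x => (fun j => (x.1 j : ℕ), fun j => (x.2 j : ℕ))
  have hφ : Function.Injective φ := by
    rintro ⟨d, l⟩ ⟨d', l'⟩ h
    simp only [φ, Prod.mk.injEq] at h
    exact Prod.ext (funext fun j => Fin.ext (congrFun h.1 j))
      (funext fun j => Fin.ext (congrFun h.2 j))
  have himg : S = φ '' (φ ⁻¹' S) := by
    rw [Set.image_preimage_eq_inter_range, eq_comm, Set.inter_eq_left]
    intro p hp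
    exact ⟨(fun j => ⟨p.1 j, Nat.lt_succ_of_le (hS p hp j).1⟩,
      fun j => ⟨p.2 j, Nat.lt_succ_of_le (hS p hp j).2⟩), rfl⟩
  refine ⟨by rw [himg]; exact (Set.toFinite _).image φ, ?_⟩
  conv_lhs => rw [himg]
  rw [finsum_mem_image hφ.injOn, finsum_mem_def, finsum_eq_sum_of_fintype, Fintype.sum_prod_type]
  rfl

theorem oddCoeff_eq_chainCoeff {b : ℕ} (d l : Fin (b + 1) → ℕ) :
    oddCoeff d l = chainCoeff (Fin.cons 1 d : Fin (b + 2) → ℕ) l := by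
  simp only [oddCoeff, chainCoeff, distributions, Fin.cons_succ]
  refine Finset.prod_congr rfl fun s _ => ?_
  rw [Nat.add_comm (d s)]

theorem evenCoeff_eq_chainCoeff {b : ℕ} (d l : Fin (b + 1) → ℕ) :
    evenCoeff d l = chainCoeff (Fin.snoc d 0 : Fin (b + 2) → ℕ) l := by
  simp only [evenCoeff, chainCoeff, distributions, Fin.snoc_castSucc]

/-- The closed form of the factor which comes from the unmarked levels. -/
theorem unmarked_factor {K : Type*} [Field K] {i x w w' : K} (hi : i ^ 2 = -1) (hx : x ≠ 0)
    (hw : w ≠ 0) (hw' : w' ≠ 0) (n p S T : ℕ) :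
    (-x ^ 2) ^ n / ((i * x) ^ n * w * ((i * x) ^ (n + 1) * w')) *
        (((i * x) ^ n * w / ((i * x) ^ (n + 1) * w')) ^ p * (x ^ T * (-x ^ 2) ^ S)) =
      w ^ ((p : ℤ) - 1) / w' ^ ((p : ℤ) + 1) * i ^ (2 * (S : ℤ) - p - 1) *
        x ^ (-1 - (p : ℤ) + (2 * S + T)) := by
  have hi0 : i ≠ 0 := by
    rintro rfl
    norm_num at hi
  have e1 : -x ^ 2 = (i * x) ^ 2 := by rw [mul_pow, hi]; ring
  have e2 : 2 * (S : ℤ) - p - 1 = ((2 * S : ℕ) : ℤ) - ((p + 1 : ℕ) : ℤ) := by push_cast; ring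
  have e3 : -1 - (p : ℤ) + (2 * S + T) = ((2 * S + T : ℕ) : ℤ) - ((p + 1 : ℕ) : ℤ) := by
    push_cast; ring
  have e4 : (p : ℤ) + 1 = ((p + 1 : ℕ) : ℤ) := by push_cast; ring
  have e5 : (i * x) ^ n * w / ((i * x) ^ (n + 1) * w') = w / (i * x * w') := by
    rw [pow_succ]; field_simp
  rw [e1, e2, e3, e4, e5, div_pow, zpow_sub₀ hw, zpow_sub₀ hi0, zpow_sub₀ hx]
  simp only [zpow_natCast, zpow_one]
  field_simp
  ring

theorem distributions_one_zero (q : ℕ) : distributions 1 q 0 = 1 := by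
  simp [distributions]

section Levels

open PowerSeries MotzkinTree

theorem weightGF_mul_of_lt {q h : ℕ} (hq : 2 * h + 1 < q) :
    weightGF q h * (1 - C xL + C (xL ^ 2) * weightGF q (h + 1)) = 1 := by
  have h1 := weightGF_mul q h
  rw [Nat.choose_eq_zero_of_lt (by omega : 2 * h < q), Nat.choose_eq_zero_of_lt hq] at h1
  rw [map_neg] at h1
  linear_combination h1

theorem prod_ite_zero_pow {K : Type*} [Field K] {b : ℕ} (ρ y : K) (d : Fin (b + 1) → ℕ) :
    ∏ j : Fin (b + 1), ((if (j : ℕ) = 0 then ρ else 1) * y) ^ d j =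
      ρ ^ d 0 * y ^ ∑ j, d j := by
  simp only [mul_pow, Finset.prod_mul_distrib, Finset.prod_pow_eq_pow_sum]
  rw [Fin.prod_univ_succ]
  simp

/-- For `[2k + 1]` the marked levels are those at height at least `k`. The unmarked levels turn the
level at height `k` into `H = 1 / (1 - (E / B) z)`, which has the shape of a continued fraction
whose top level is scaled by `E / B`. -/
theorem coe_signedGF_odd {r k b : ℕ} (hr : 1 ≤ r)
    (hb : r < (2 * k + 2 * b + 2).choose (2 * k)) :
    (oddSeqs r k b).Finite ∧
      (signedGF (2 * k + 1) r : LaurentSeries ℂ) = ∑ᶠ p ∈ oddSeqs r k b, oddTerm k p.1 p.2 := by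
  classical
  have hc : ∀ j, 0 < (2 * (k + j)).choose (2 * k) := fun j => Nat.choose_pos (by omega)
  obtain ⟨hfin, hsum⟩ := finite_and_finsum_mem_eq (R := r) (S := oddSeqs r k b) (by
    rintro ⟨d, l⟩ h j
    have h' : r = ∑ j, d j * ((2 * k + 2 * (j : ℕ) + 1).choose (2 * k) +
        (2 * k + 2 * (j : ℕ)).choose (2 * k)) + ∑ j, l j * (2 * k + 2 * (j : ℕ)).choose (2 * k) := h
    have h1 : (d j * _ : ℕ) ≤ _ := Finset.single_le_sum
      (f := fun j : Fin (b + 1) => d j * ((2 * k + 2 * (j : ℕ) + 1).choose (2 * k) +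
        (2 * k + 2 * (j : ℕ)).choose (2 * k))) (fun _ _ => Nat.zero_le _) (Finset.mem_univ j)
    have h2 : (l j * _ : ℕ) ≤ _ := Finset.single_le_sum
      (f := fun j : Fin (b + 1) => l j * (2 * k + 2 * (j : ℕ)).choose (2 * k))
      (fun _ _ => Nat.zero_le _) (Finset.mem_univ j)
    have h3 : 0 < (2 * k + 2 * (j : ℕ)).choose (2 * k) := Nat.choose_pos (by omega)
    have h4 := Nat.le_mul_of_pos_right (d j) (Nat.add_pos_right
      ((2 * k + 2 * (j : ℕ) + 1).choose (2 * k)) h3)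
    have h5 := Nat.le_mul_of_pos_right (l j) h3
    exact ⟨by simp only; omega, by simp only; omega⟩) fun p => oddTerm k p.1 p.2
  refine ⟨hfin, ?_⟩
  rw [hsum, coe_signedGF]
  set E := convergentDen xL (k + 1) with hE
  set B := convergentDen xL (k + 2) + xL * convergentDen xL (k + 1) with hB
  have hE0 : E ≠ 0 := convergentDen_ne_zero k
  have hB0 : B ≠ 0 := convergentDen_add_ne_zero k
  set z : (LaurentSeries ℂ)⟦X⟧ := C xL * X ^ (2 * k).choose (2 * k) +
    C (-xL ^ 2) * X ^ ((2 * k).choose (2 * k) + (2 * k + 1).choose (2 * k)) *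
      weightGF (2 * k) (k + 1) with hz
  have hXz : X ∣ z := by
    rw [hz, Nat.choose_self]
    exact dvd_add ((dvd_pow_self X one_ne_zero).mul_left _)
      (((dvd_pow_self X (by omega)).mul_left _).mul_right _)
  obtain ⟨H, hH⟩ := exists_mul_one_sub_eq_one (hXz.mul_left (C (E / B)))
  have hconv := convergent_mul xL k (G := weightGF (2 * k)) (Y := z - C xL)
    (fun h hh => weightGF_mul_of_lt (by omega)) (by
      rw [hz]; linear_combination weightGF_mul (2 * k) k)
  rw [coeff_of_mul_linear_eq (A := E + xL * convergentDen xL k) (F := convergentDen xL k)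
    hB0 hE0 (H := H) (z := z) (by
      simp only [hB, hE, map_add, map_mul]
      linear_combination hconv) hH hr]
  have hcore := coeff_pow_continuedFraction (R := r) (b + 1) (s := r)
    (G := fun j => if j = 0 then H else weightGF (2 * k) (k + j))
    (a := fun j => (if j = 0 then E / B else 1) * xL)
    (a' := fun j => (if j = 0 then E / B else 1) * (-xL ^ 2))
    (c := fun j => (2 * (k + j)).choose (2 * k))
    (e := fun j => (2 * (k + j)).choose (2 * k) + (2 * (k + j) + 1).choose (2 * k))
    (fun h _ => hc h) (fun h _ => Nat.add_pos_left (hc h) _) ?_ ?_ 1 le_rfl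
  · rw [pow_one, if_pos rfl] at hcore
    rw [hcore, Finset.mul_sum]
    refine Finset.sum_congr rfl fun d _ => ?_
    rw [Finset.mul_sum]
    refine Finset.sum_congr rfl fun l _ => ?_
    rw [mul_ite, mul_zero]
    have hsq : (E + xL * convergentDen xL k) * E - convergentDen xL k * B = (-xL ^ 2) ^ k := by
      rw [← convergentDen_sq_sub]; ring
    refine if_congr ?_ ?_ rfl
    · rw [eq_comm]
      simp only [oddSeqs, Set.mem_ofPred_eq, Nat.mul_add, Nat.add_comm (Nat.choose (_ + 1) _)]
    · change _ = oddTerm k (fun j => (d j : ℕ)) (fun j => (l j : ℕ))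
      rw [hsq, Finset.prod_mul_distrib, prod_ite_zero_pow, prod_ite_zero_pow, oddTerm,
        oddCoeff_eq_chainCoeff]
      have h1 := unmarked_factor iL_sq xL_ne_zero (W_ne_zero k) (W_sub_ne_zero k) k
        ((d 0 : ℕ) + (l 0 : ℕ)) (∑ j, (d j : ℕ)) (∑ j, (l j : ℕ))
      rw [← convergentDen_eq_W, ← convergentDen_add_eq_W, ← hE, ← hB] at h1
      have h2 : -1 - (((d 0 : ℕ) : ℤ)) - ((l 0 : ℕ) : ℤ) + ∑ j, 2 * ((d j : ℕ) : ℤ) =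
          2 * ((∑ j, (d j : ℕ) : ℕ) : ℤ) - (((d 0 : ℕ) + (l 0 : ℕ) : ℕ) : ℤ) - 1 := by
        push_cast [Finset.mul_sum]
        ring
      have h3 : -1 - (((d 0 : ℕ) : ℤ)) - ((l 0 : ℕ) : ℤ) +
            ∑ j, (2 * ((d j : ℕ) : ℤ) + ((l j : ℕ) : ℤ)) =
          -1 - (((d 0 : ℕ) + (l 0 : ℕ) : ℕ) : ℤ) +
            (2 * ((∑ j, (d j : ℕ) : ℕ) : ℤ) + ((∑ j, (l j : ℕ) : ℕ) : ℤ)) := by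
        push_cast [Finset.mul_sum, Finset.sum_add_distrib]
        ring
      rw [h2, h3, ← Nat.cast_add]
      linear_combination (chainCoeff (Fin.cons 1 fun j => (d j : ℕ) : Fin (b + 2) → ℕ)
        (fun j => (l j : ℕ)) : LaurentSeries ℂ) * h1
  · intro h hh
    rcases h with _ | h
    · simp only [if_true, Nat.add_zero, Nat.zero_add, one_ne_zero, if_false, map_mul]
      rw [hz] at hH
      linear_combination hH
    · have := weightGF_mul (2 * k) (k + (h + 1))
      simpa [Nat.add_assoc] using this
  · have h1 : (2 * k + 2 * b + 2).choose (2 * k) = (2 * (k + (b + 1))).choose (2 * k) := by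
      congr 1; omega
    rw [if_neg (Nat.succ_ne_zero b)]
    exact dvd_sub_one_of_mul_eq_one (by omega) (by omega) (weightGF_mul (2 * k) (k + (b + 1)))

/-- For `[2k + 2]` the lowest marked objects are the arches at height `k`, while the fixed points at
height `k` are still unmarked. -/
theorem coe_signedGF_even {r k b : ℕ} (hr : 1 ≤ r) (hb : r < (2 * k + 2 * b + 4).choose (2 * k + 1))
    (hb' : r < (2 * k + 2 * b + 2).choose (2 * k + 1) + (2 * k + 2 * b + 3).choose (2 * k + 1)) :
    (evenSeqs r (k + 1) b).Finite ∧
      (signedGF (2 * k + 2) r : LaurentSeries ℂ) =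
        ∑ᶠ p ∈ evenSeqs r (k + 1) b, evenTerm (k + 1) p.1 p.2 := by
  classical
  -- The marks of a fixed point and of an arch at height `k + j`
  let c : ℕ → ℕ := fun j => (2 * (k + j)).choose (2 * k + 1)
  let e : ℕ → ℕ := fun j => (2 * (k + j)).choose (2 * k + 1) + (2 * (k + j) + 1).choose (2 * k + 1)
  have hc : ∀ j, 0 < c (j + 1) := fun j => Nat.choose_pos (by omega)
  have he : ∀ j, 0 < e j := fun j => Nat.add_pos_right _ (Nat.choose_pos (by omega))
  have hmem : ∀ d l : Fin (b + 1) → ℕ, (d, l) ∈ evenSeqs r (k + 1) b ↔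
      r = ∑ j, d j * e j + ∑ j, l j * c (j + 1) := by
    intro d l
    have h1 : ∀ j : Fin (b + 1), 2 * (k + (j + 1)) - 2 = 2 * (k + j) := by omega
    have h2 : ∀ j : Fin (b + 1), 2 * (k + (j + 1)) - 1 = 2 * (k + j) + 1 := by omega
    have h3 : ∀ j : Fin (b + 1), 2 * (k + 1) + 2 * (j : ℕ) = 2 * (k + (j + 1)) := by omega
    have h4 : 2 * (k + 1) - 1 = 2 * k + 1 := by omega
    simp only [evenSeqs, Set.mem_ofPred_eq, h1, h2, h4, h3, c, e]
  obtain ⟨hfin, hsum⟩ := finite_and_finsum_mem_eq (R := r) (S := evenSeqs r (k + 1) b) (by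
    rintro ⟨d, l⟩ h j
    rw [hmem] at h
    have h1 : d j * e j ≤ _ := Finset.single_le_sum
      (f := fun j : Fin (b + 1) => d j * e j) (fun _ _ => Nat.zero_le _) (Finset.mem_univ j)
    have h2 : l j * c (j + 1) ≤ _ := Finset.single_le_sum
      (f := fun j : Fin (b + 1) => l j * c (j + 1))
      (fun _ _ => Nat.zero_le _) (Finset.mem_univ j)
    have h4 := Nat.le_mul_of_pos_right (d j) (he j)
    have h5 := Nat.le_mul_of_pos_right (l j) (hc j)
    exact ⟨by simp only; omega, by simp only; omega⟩) fun p => evenTerm (k + 1) p.1 p.2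
  refine ⟨hfin, ?_⟩
  rw [hsum, coe_signedGF]
  set E := convergentDen xL (k + 1) with hE
  set B := convergentDen xL (k + 2) with hB
  have hE0 : E ≠ 0 := convergentDen_ne_zero k
  have hB0 : B ≠ 0 := convergentDen_ne_zero (k + 1)
  set z : (LaurentSeries ℂ)⟦X⟧ := C (-xL ^ 2) * X ^ e 0 * weightGF (2 * k + 1) (k + 1) with hz
  have hXz : X ∣ z := ((dvd_pow_self X (he 0).ne').mul_left _).mul_right _
  obtain ⟨H, hH⟩ := exists_mul_one_sub_eq_one (hXz.mul_left (C (E / B)))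
  have hconv := convergent_mul xL k (G := weightGF (2 * k + 1)) (Y := z)
    (fun h hh => weightGF_mul_of_lt (by omega)) (by
      have h1 := weightGF_mul (2 * k + 1) k
      rw [Nat.choose_eq_zero_of_lt (by omega : 2 * k < 2 * k + 1), pow_zero, mul_one] at h1
      rw [hz]
      simpa [e, Nat.choose_eq_zero_of_lt (by omega : 2 * k < 2 * k + 1)] using h1)
  rw [coeff_of_mul_linear_eq (A := E) (F := convergentDen xL k) hB0 hE0 (H := H) (z := z) hconv
    hH hr]
  -- The fixed points at height `k` are accounted for in `B`, so the top level has none; its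
  -- coefficient `0` comes with the mark `r + 1` because the marks have to be positive.
  have hcore := coeff_pow_continuedFraction (R := r) (b + 2) (s := r)
    (G := fun j => if j = 0 then H else weightGF (2 * k + 1) (k + j))
    (a := fun j => if j = 0 then 0 else xL)
    (a' := fun j => (if j = 0 then E / B else 1) * (-xL ^ 2))
    (c := fun j => if j = 0 then r + 1 else c j) (e := e)
    ?_ (fun h _ => he h) ?_ ?_ 1 le_rfl
  · rw [pow_one, if_pos rfl] at hcore
    rw [hcore, Fintype.sum_fin_succ_fun_snoc, Finset.sum_eq_single 0, Finset.mul_sum]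
    · refine Finset.sum_congr rfl fun d _ => ?_
      rw [Fintype.sum_fin_succ_fun, Finset.sum_eq_single 0, Finset.mul_sum]
      · refine Finset.sum_congr rfl fun l _ => ?_
        rw [mul_ite, mul_zero]
        have hsq : E * E - convergentDen xL k * B = (-xL ^ 2) ^ k := by
          rw [← convergentDen_sq_sub]; ring
        refine if_congr ?_ ?_ rfl
        · rw [hmem, eq_comm, Fin.sum_univ_castSucc, Fin.sum_univ_succ (n := b + 1)]
          simp
        · change _ = evenTerm (k + 1) (fun j => (d j : ℕ)) (fun j => (l j : ℕ))
          rw [hsq, Fin.val_comp_snoc, Fin.val_comp_cons, Fin.val_zero, evenTerm,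
            evenCoeff_eq_chainCoeff, chainCoeff_cons, Finset.prod_mul_distrib,
            Fin.prod_univ_succ (n := b + 1), Fin.prod_univ_castSucc (n := b + 1)]
          have h1 := unmarked_factor iL_sq xL_ne_zero (W_ne_zero k) (W_ne_zero (k + 1)) k
            (d 0 : ℕ) (∑ j, (d j : ℕ)) (∑ j, (l j : ℕ))
          rw [← convergentDen_eq_W, ← convergentDen_eq_W, ← hE, ← hB] at h1
          have h2 : ∑ j, 2 * ((d j : ℕ) : ℤ) - ((d 0 : ℕ) : ℤ) - 1 =
              2 * ((∑ j, (d j : ℕ) : ℕ) : ℤ) - ((d 0 : ℕ) : ℤ) - 1 := by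
            push_cast [Finset.mul_sum]
            ring
          have h3 : -1 - (((d 0 : ℕ) : ℤ)) + ∑ j, (2 * ((d j : ℕ) : ℤ) + ((l j : ℕ) : ℤ)) =
              -1 - (((d 0 : ℕ) : ℤ)) +
                (2 * ((∑ j, (d j : ℕ) : ℕ) : ℤ) + ((∑ j, (l j : ℕ) : ℕ) : ℤ)) := by
            push_cast [Finset.mul_sum, Finset.sum_add_distrib]
            ring
          simp only [Fin.cons_zero, Fin.cons_succ, Fin.val_zero, pow_zero, one_mul, Fin.val_succ,
            Nat.succ_ne_zero, if_false, Fin.snoc_castSucc, Fin.snoc_last, Fin.val_castSucc,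
            mul_one, Finset.prod_pow_eq_pow_sum, distributions_one_zero]
          rw [prod_ite_zero_pow, h2, h3, Nat.add_sub_cancel]
          linear_combination (chainCoeff (Fin.snoc (fun j => (d j : ℕ)) 0 : Fin (b + 2) → ℕ)
            (fun j => (l j : ℕ)) : LaurentSeries ℂ) * h1
      · intro l₀ _ hl
        refine Finset.sum_eq_zero fun l _ => if_neg fun h => ?_
        have h1 := Finset.single_le_sum (f := fun j : Fin (b + 2) =>
          ((Fin.cons l₀ l : Fin (b + 2) → Fin (r + 1)) j : ℕ) * if (j : ℕ) = 0 then r + 1 else c j)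
          (fun _ _ => Nat.zero_le _) (Finset.mem_univ 0)
        simp only [Fin.cons_zero, Fin.val_zero, if_true] at h1
        have h2 := Nat.le_mul_of_pos_left (r + 1) (Nat.pos_of_ne_zero (Fin.val_ne_zero_iff.mpr hl))
        omega
      · simp
    · intro x _ hx
      -- An arch at height `k + b + 1` has a mark above `r`.
      refine Finset.sum_eq_zero fun d _ => Finset.sum_eq_zero fun l _ => if_neg fun h => ?_
      have h1 := Finset.single_le_sum (f := fun j : Fin (b + 2) =>
        ((Fin.snoc d x : Fin (b + 2) → Fin (r + 1)) j : ℕ) * e j)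
        (fun _ _ => Nat.zero_le _) (Finset.mem_univ (Fin.last (b + 1)))
      simp only [Fin.snoc_last, Fin.val_last] at h1
      have h2 := Nat.le_mul_of_pos_left (e (b + 1))
        (Nat.pos_of_ne_zero (Fin.val_ne_zero_iff.mpr hx))
      have h3 : e (b + 1) = (2 * k + 2 * b + 2).choose (2 * k + 1) +
          (2 * k + 2 * b + 3).choose (2 * k + 1) := by
        simp only [e]; congr 2 <;> omega
      omega
    · simp
  · rintro (_ | h) _
    · simp
    · simpa using hc h
  · rintro (_ | h) hh
    · simp only [if_true, Nat.zero_add, one_ne_zero, if_false, map_mul, map_zero, zero_mul,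
        sub_zero]
      rw [hz] at hH
      linear_combination hH
    · have := weightGF_mul (2 * k + 1) (k + (h + 1))
      simpa [c, e, Nat.add_assoc] using this
  · have h1 : (2 * k + 2 * b + 4).choose (2 * k + 1) = (2 * (k + (b + 2))).choose (2 * k + 1) := by
      congr 1; omega
    rw [if_neg (Nat.succ_ne_zero (b + 1))]
    exact dvd_sub_one_of_mul_eq_one (by omega) (by omega) (weightGF_mul (2 * k + 1) (k + (b + 2)))

end Levels

/-! ### The case `r = 1` and the conclusion -/

theorem sum_fin_zero_add_one (f : Fin (0 + 1) → ℕ) : ∑ j, f j = f 0 := Fin.sum_univ_one f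

theorem pair_eq_iff (d l : Fin (0 + 1) → ℕ) (x y : ℕ) :
    (d, l) = (fun _ => x, fun _ => y) ↔ d 0 = x ∧ l 0 = y := by
  have h : ∀ f : Fin (0 + 1) → ℕ, ∀ z, f = (fun _ => z) ↔ f 0 = z := fun f z =>
    ⟨fun h => congrFun h 0, fun h => funext fun j => by rw [← h, Fin.fin_one_eq_zero j]⟩
  rw [Prod.mk.injEq, h, h]

theorem evenSeqs_one (k : ℕ) : evenSeqs 1 (k + 1) 0 = {(fun _ => 1, fun _ => 0)} := by
  ext ⟨d, l⟩
  have h1 : (2 * (k + 1)).choose (2 * k + 1) = 2 * k + 2 := Nat.choose_succ_self_right (2 * k + 1)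
  have h2 : 2 * (k + 1) - 2 = 2 * k := by omega
  have h3 : 2 * (k + 1) - 1 = 2 * k + 1 := by omega
  simp only [evenSeqs, Set.mem_ofPred_eq, Set.mem_singleton_iff, pair_eq_iff, sum_fin_zero_add_one,
    Fin.val_zero, mul_zero, add_zero, h1, h2, h3, Nat.choose_succ_self, Nat.choose_self, zero_add,
    mul_one]
  constructor
  · intro h
    rcases Nat.eq_zero_or_pos (l 0) with hl | hl
    · rw [hl] at h; omega
    · have := Nat.mul_le_mul_right (2 * k + 2) hl
      omega
  · rintro ⟨h, h'⟩
    simp [h, h']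

theorem oddSeqs_one {k : ℕ} (hk : 1 ≤ k) : oddSeqs 1 k 0 = {(fun _ => 0, fun _ => 1)} := by
  ext ⟨d, l⟩
  simp only [oddSeqs, Set.mem_ofPred_eq, Set.mem_singleton_iff, pair_eq_iff, sum_fin_zero_add_one,
    Fin.val_zero, mul_zero, add_zero, Nat.choose_succ_self_right, Nat.choose_self, mul_one]
  constructor
  · intro h
    rcases Nat.eq_zero_or_pos (d 0) with hd | hd
    · rw [hd] at h; omega
    · have := Nat.mul_le_mul_right (2 * k + 1 + 1) hd
      omega
  · rintro ⟨h, h'⟩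
    simp [h, h']

theorem mainTheorem5 :
    (∀ r k b : ℕ, 1 ≤ r → 1 ≤ k →
      r < min ((2 * k + 2 * b + 2).choose (2 * k - 1))
            ((2 * k + 2 * b).choose (2 * k - 1) + (2 * k + 2 * b + 1).choose (2 * k - 1)) →
      (evenSeqs r k b).Finite ∧
      (signedGF (2 * k) r : LaurentSeries ℂ) = ∑ᶠ p ∈ evenSeqs r k b, evenTerm k p.1 p.2) ∧
    (∀ r k b : ℕ, 1 ≤ r → 1 ≤ k →
      (2 * k + 2 * b).choose (2 * k) ≤ r → r < (2 * k + 2 * b + 2).choose (2 * k) →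
      (oddSeqs r k b).Finite ∧
      (signedGF (2 * k + 1) r : LaurentSeries ℂ) = ∑ᶠ p ∈ oddSeqs r k b, oddTerm k p.1 p.2) ∧
    (∀ k : ℕ, 1 ≤ k → (signedGF (2 * k) 1 : LaurentSeries ℂ) = 1 / W k ^ 2) ∧
    (∀ k : ℕ, 1 ≤ k →
      (signedGF (2 * k + 1) 1 : LaurentSeries ℂ) = -1 / (xL * (W (k + 1) - iL * W k) ^ 2)) := by
  have heven : ∀ r k b : ℕ, 1 ≤ r → 1 ≤ k →
      r < min ((2 * k + 2 * b + 2).choose (2 * k - 1))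
            ((2 * k + 2 * b).choose (2 * k - 1) + (2 * k + 2 * b + 1).choose (2 * k - 1)) →
      (evenSeqs r k b).Finite ∧
      (signedGF (2 * k) r : LaurentSeries ℂ) = ∑ᶠ p ∈ evenSeqs r k b, evenTerm k p.1 p.2 := by
    intro r k b hr hk hb
    obtain ⟨k, rfl⟩ : ∃ k', k = k' + 1 := ⟨k - 1, by omega⟩
    rw [show 2 * (k + 1) - 1 = 2 * k + 1 by omega,
      show 2 * (k + 1) + 2 * b + 2 = 2 * k + 2 * b + 4 by ring,
      show 2 * (k + 1) + 2 * b + 1 = 2 * k + 2 * b + 3 by ring,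
      show 2 * (k + 1) + 2 * b = 2 * k + 2 * b + 2 by ring, lt_min_iff] at hb
    exact coe_signedGF_even hr hb.1 hb.2
  refine ⟨heven, fun r k b hr _ _ hb => coe_signedGF_odd hr hb, fun k hk => ?_, fun k hk => ?_⟩
  · obtain ⟨k, rfl⟩ : ∃ k', k = k' + 1 := ⟨k - 1, by omega⟩
    have h1 : (2 * k + 2).choose (2 * k + 1) = 2 * k + 2 :=
      Nat.choose_succ_self_right (2 * k + 1)
    have h2 : 1 ≤ (2 * k + 3).choose (2 * k + 1) := Nat.choose_pos (by omega)
    have h3 : (2 * k + 2).choose (2 * k + 1) ≤ (2 * k + 4).choose (2 * k + 1) :=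
      Nat.choose_le_choose _ (by omega)
    rw [show 2 * (k + 1) = 2 * k + 2 by ring,
      (coe_signedGF_even (r := 1) (k := k) (b := 0) le_rfl
        (by simp only [Nat.mul_zero, Nat.add_zero]; omega)
        (by simp only [Nat.mul_zero, Nat.add_zero]; omega)).2,
      evenSeqs_one, finsum_mem_singleton, evenTerm, evenCoeff_eq_chainCoeff]
    simp [chainCoeff, distributions, Fin.snoc]
  · have h1 : (2 * k + 1).choose (2 * k) ≤ (2 * k + 2).choose (2 * k) :=
      Nat.choose_le_choose _ (by omega)
    rw [Nat.choose_succ_self_right] at h1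
    rw [(coe_signedGF_odd (r := 1) (k := k) (b := 0) le_rfl
        (by simp only [Nat.mul_zero, Nat.add_zero]; omega)).2,
      oddSeqs_one hk, finsum_mem_singleton, oddTerm, oddCoeff_eq_chainCoeff]
    simp [chainCoeff, distributions]
    have h2 : (-1 : LaurentSeries ℂ)⁻¹ = -1 := inv_eq_of_mul_eq_one_right (by ring)
    rw [iL_sq, h2, div_eq_mul_inv, mul_inv]
    ring
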